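/- Let $\mathbb{Z}[x_1,x_2,\dots]$ be the polynomial ring in countably many variables. For $i\ge 1$ let $\partial_i f=\frac{f-s_if}{x_i-x_{i+1}}$, where $s_i$ exchanges $x_i$ and $x_{i+1}$, let $R_if=f(x_1,\dots,x_{i-1},0,x_i,x_{i+1},\dots)$, and let $T_i=R_i\partial_i$ be the quasisymmetric divided difference. For $w\in S_n$ let $\ell(w)$ be the number of inversions of $w$, and let $\mathfrak{S}_w\in\mathbb{Z}[x_1,\dots,x_n]$ be the Schubert polynomial of $w$, determined by $\mathfrak{S}_{w_0}=x_1^{n-1}x_2^{n-2}\cdots x_{n-1}$ for the longest element $w_0$ and $\mathfrak{S}_{ws_i}=\partial_i\mathfrak{S}_w$ whenever $w(i)>w(i+1)$. For $f\in\mathbb{Z}[x_1,\dots,x_n]$ the divided symmetrization is $$\langle f\rangle_n=\sum_{\sigma\in S_n}\frac{f(x_{\sigma(1)},\dots,x_{\sigma(n)})}{(x_{\sigma(1)}-x_{\sigma(2)})\cdots(x_{\sigma(n-1)}-x_{\sigma(n)})}.$$ **Theorem.** Let $n\ge 1$ and let $w\in S_n$ with $\ell(w)=n-1$. Then there is a sequence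 $(i_1,\dots,i_{n-1})$ of positive integers with $i_j\le j$ for $1\le j\le n-1$ such that the polynomial $T_{i_1}T_{i_2}\cdots T_{i_{n-1}}\mathfrak{S}_w$ (with $T_{i_{n-1}}$ applied first) is a constant equal to a positive integer. Moreover the divided symmetrization $a_w=\langle\mathfrak{S}_w\rangle_n$ is a positive integer. -/

import Mathlib

/-- The polynomial ring `ℤ[x₁, x₂, …]`. Indices start at `0` in the code: the variable `x_{k+1}`
is `X k`, and `ℤ[x₁, …, xₙ]` is the subring of polynomials in `X 0, …, X (n - 1)`. -/
abbrev ZPoly : Type := MvPolynomial ℕ ℤ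

/-- The action of the adjacent transposition exchanging the variables `X i` and `X (i + 1)`. -/
noncomputable def swapVars (i : ℕ) : ZPoly →ₐ[ℤ] ZPoly :=
  MvPolynomial.rename (Equiv.swap i (i + 1))

theorem sub_dvd_sub_swapVars (i : ℕ) (f : ZPoly) :
    (MvPolynomial.X i - MvPolynomial.X (i + 1) : ZPoly) ∣ f - swapVars i f := by
  induction f using MvPolynomial.induction_on with
  | C a => simp [swapVars]
  | add p q hp hq =>
    have h : p + q - swapVars i (p + q) = (p - swapVars i p) + (q - swapVars i q) := by
      rw [map_add]; ring
    rw [h]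
    exact dvd_add hp hq
  | mul_X p k hp =>
    have h : p * MvPolynomial.X k - swapVars i (p * MvPolynomial.X k)
        = (p - swapVars i p) * MvPolynomial.X k
          + swapVars i p * (MvPolynomial.X k - swapVars i (MvPolynomial.X k)) := by
      rw [map_mul]; ring
    rw [h]
    refine dvd_add (hp.mul_right _) (Dvd.dvd.mul_left ?_ _)
    simp only [swapVars, MvPolynomial.rename_X]
    rcases eq_or_ne k i with rfl | h1
    · rw [Equiv.swap_apply_left]
    · rcases eq_or_ne k (i + 1) with rfl | h2
      · rw [Equiv.swap_apply_right]
        exact ⟨-1, by ring⟩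
      · rw [Equiv.swap_apply_of_ne_of_ne h1 h2, sub_self]
        exact dvd_zero _

/-- The divided difference `(f - sᵢ f) / (xᵢ - xᵢ₊₁)`, where `sᵢ` exchanges `xᵢ` and `xᵢ₊₁`
(`i` counted from `0`): the unique polynomial whose product with `xᵢ - xᵢ₊₁` is `f - sᵢ f`. -/
noncomputable def dividedDiff (i : ℕ) (f : ZPoly) : ZPoly :=
  (sub_dvd_sub_swapVars i f).choose

theorem dividedDiff_spec (i : ℕ) (f : ZPoly) :
    f - swapVars i f
      = (MvPolynomial.X i - MvPolynomial.X (i + 1)) * dividedDiff i f :=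
  (sub_dvd_sub_swapVars i f).choose_spec

/-- The Bergeron–Sottile map: put `0` in position `i` and shift the later variables,
`f ↦ f(x₀, …, xᵢ₋₁, 0, xᵢ, xᵢ₊₁, …)` (indices counted from `0`). -/
noncomputable def bergeronSottile (i : ℕ) : ZPoly →ₐ[ℤ] ZPoly :=
  MvPolynomial.aeval fun k =>
    if k < i then MvPolynomial.X k else if k = i then 0 else MvPolynomial.X (k - 1)

/-- The quasisymmetric divided difference `T = R ∘ ∂` (`trim i` is `T_{i+1}` when indices are
counted from `1`). -/
noncomputable def trim (i : ℕ) (f : ZPoly) : ZPoly :=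
  bergeronSottile i (dividedDiff i f)

/-- The length of a permutation: its number of inversions. -/
def permLength {n : ℕ} (w : Equiv.Perm (Fin n)) : ℕ :=
  (Finset.univ.filter fun p : Fin n × Fin n => p.1 < p.2 ∧ w p.2 < w p.1).card

/-- `i` is an ascent of `w`: `w(i) < w(i+1)` (positions counted from `0`). -/
def IsAscent {n : ℕ} (w : Equiv.Perm (Fin n)) (i : ℕ) : Prop :=
  ∃ h : i + 1 < n, w ⟨i, Nat.lt_of_succ_lt h⟩ < w ⟨i + 1, h⟩

/-- The adjacent transposition of the positions `i` and `i + 1` in `Fin n`. -/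
def adjSwap {n : ℕ} (i : ℕ) (h : i + 1 < n) : Equiv.Perm (Fin n) :=
  Equiv.swap ⟨i, Nat.lt_of_succ_lt h⟩ ⟨i + 1, h⟩

theorem sum_mul_adjSwap_lt {n : ℕ} (w : Equiv.Perm (Fin n)) (i : ℕ) (h : i + 1 < n)
    (hw : w ⟨i, Nat.lt_of_succ_lt h⟩ < w ⟨i + 1, h⟩) :
    ∑ k : Fin n, (k : ℕ) * ((w * adjSwap i h) k : ℕ) < ∑ k : Fin n, (k : ℕ) * (w k : ℕ) := by
  set a : Fin n := ⟨i, Nat.lt_of_succ_lt h⟩ with ha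
  set b : Fin n := ⟨i + 1, h⟩ with hb
  have hab : b ≠ a := by simp [ha, hb]
  have key : ∀ F : Fin n → ℕ,
      ∑ k, F k = F a + (F b + ∑ k ∈ (Finset.univ.erase a).erase b, F k) := by
    intro F
    rw [Finset.add_sum_erase _ F (Finset.mem_erase.2 ⟨hab, Finset.mem_univ b⟩),
      Finset.add_sum_erase _ F (Finset.mem_univ a)]
  rw [key fun k => (k : ℕ) * ((w * adjSwap i h) k : ℕ), key fun k => (k : ℕ) * (w k : ℕ)]
  have hrest : ∑ k ∈ (Finset.univ.erase a).erase b, (k : ℕ) * ((w * adjSwap i h) k : ℕ)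
      = ∑ k ∈ (Finset.univ.erase a).erase b, (k : ℕ) * (w k : ℕ) := by
    refine Finset.sum_congr rfl fun k hk => ?_
    simp only [Finset.mem_erase] at hk
    rw [Equiv.Perm.mul_apply, adjSwap, Equiv.swap_apply_of_ne_of_ne hk.2.1 hk.1]
  have h1 : (w * adjSwap i h) a = w b := by simp [adjSwap, ha, hb]
  have h2 : (w * adjSwap i h) b = w a := by simp [adjSwap, ha, hb]
  rw [hrest, h1, h2]
  have hlt : (w a : ℕ) < (w b : ℕ) := hw
  have e1 : (a : ℕ) = i := rfl
  have e2 : (b : ℕ) = i + 1 := rfl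
  rw [e1, e2]
  nlinarith

open Classical in
/-- The Schubert polynomial of `w ∈ Sₙ`, by descending recursion from the longest permutation
`w₀`: `𝔖_{w₀} = x₁^{n-1} x₂^{n-2} ⋯ x_{n-1}`, and `𝔖_w = ∂ᵢ 𝔖_{w sᵢ}` for an ascent `i` of `w`.
The code uses the first ascent; by the braid relations of the divided differences every other
choice gives the same polynomial. Only `w₀` has no ascent. -/
noncomputable def schubert {n : ℕ} (w : Equiv.Perm (Fin n)) : ZPoly :=
  if h : ∃ i, IsAscent w i then
    dividedDiff (Nat.find h) (schubert (w * adjSwap (Nat.find h) (Nat.find_spec h).1))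
  else ∏ k ∈ Finset.range n, MvPolynomial.X k ^ (n - 1 - k)
termination_by ∑ k : Fin n, (k : ℕ) * (w k : ℕ)
decreasing_by exact sum_mul_adjSwap_lt w _ _ (Nat.find_spec h).2

/-- A permutation of the first `n` variable indices, extended by the identity to all of `ℕ`. -/
noncomputable def extendPerm {n : ℕ} (σ : Equiv.Perm (Fin n)) : Equiv.Perm ℕ :=
  σ.extendDomain Fin.equivSubtype

/-- The divided symmetrization
`⟨f⟩ₙ = ∑_{σ ∈ Sₙ} f(x_{σ(1)}, …, x_{σ(n)}) / ∏_{1 ≤ k ≤ n-1} (x_{σ(k)} - x_{σ(k+1)})`,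
as a rational function. -/
noncomputable def dividedSymm (n : ℕ) (f : ZPoly) : FractionRing ZPoly :=
  ∑ σ : Equiv.Perm (Fin n),
    algebraMap ZPoly (FractionRing ZPoly) (MvPolynomial.rename (extendPerm σ) f) /
      algebraMap ZPoly (FractionRing ZPoly) (∏ k ∈ Finset.range (n - 1),
        (MvPolynomial.X (extendPerm σ k) - MvPolynomial.X (extendPerm σ (k + 1))))

/-!
The divided symmetrization and the compositions of the operators `T` are two descriptions of one
functional. Let `trimSum m f` be the sum of the constant terms of `T_{i₀} ⋯ T_{i_{m-1}} f` over all
sequences with `i_j ≤ j` (indices from `0`). For `f` homogeneous of degree `m`, the divided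
symmetrization in `m + 1` variables is an integer, since it is the quotient of an alternating
polynomial by a Vandermonde determinant of the same degree. It may therefore be computed with the
last variable equal to `0`; grouping the permutations by the place of that variable and summing by
parts gives the recursion that defines `trimSum` (`dividedSymm_eq_trimSum`). Hence both assertions
follow from `0 < trimSum m 𝔖_w`: the value is the divided symmetrization, and one of the summands has
to be positive (`exists_foldr_trim_pos`).

Positivity is proved as follows. Write `uₐ = x₀ + ⋯ + x_{a-1}`.

* `trimSum m` vanishes on the ideal generated by `u_{m+1}` and the forms `u_{i+1} (xᵢ - xᵢ₊₁)` with
  `i < m` (`trimSum_varSum_succ_mul`, `trimSum_quadForm_mul`), by induction on `m`.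
* Modulo this ideal the operator `∑ u_{i+1} ∂ᵢ` is a derivation that fixes the variables, so it
  multiplies homogeneous polynomials by their degree (`eulerOp_sub_mem`). For a Schubert polynomial
  this says that `ℓ(w) 𝔖_w` is congruent to the sum of `u_{i+1} 𝔖_{w sᵢ}` over the descents `i` of
  `w`. Iterating down to the identity expresses `trimSum m 𝔖_w` through the values on products of `m`
  of the forms `u₁, …, u_m`.
* These values, the mixed Eulerian numbers, are positive because each `T_k` takes a product of forms
  `uₐ` to a nonnegative combination of such products, and for a suitable `k` one of these is again a
  product of forms with indices in the range allowed for `m - 1` (`trimSum_prod_varSum_pos`).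
-/

open MvPolynomial

/-! ### Divided differences -/

theorem X_sub_X_ne_zero {i j : ℕ} (h : i ≠ j) : (X i - X j : ZPoly) ≠ 0 :=
  sub_ne_zero.2 fun e => h (X_injective e)

theorem dividedDiff_eq_of_mul_eq {i : ℕ} {f g : ZPoly}
    (h : f - swapVars i f = (X i - X (i + 1)) * g) : dividedDiff i f = g :=
  mul_left_cancel₀ (X_sub_X_ne_zero (Nat.succ_ne_self i).symm) ((dividedDiff_spec i f).symm.trans h)

theorem dividedDiff_add (i : ℕ) (f g : ZPoly) :
    dividedDiff i (f + g) = dividedDiff i f + dividedDiff i g :=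
  dividedDiff_eq_of_mul_eq <| by
    rw [map_add]; linear_combination dividedDiff_spec i f + dividedDiff_spec i g

/-- The Leibniz rule for divided differences. -/
theorem dividedDiff_mul (i : ℕ) (f g : ZPoly) :
    dividedDiff i (f * g) = dividedDiff i f * g + swapVars i f * dividedDiff i g :=
  dividedDiff_eq_of_mul_eq <| by
    rw [map_mul]
    linear_combination g * dividedDiff_spec i f + swapVars i f * dividedDiff_spec i g

theorem dividedDiff_C (i : ℕ) (c : ℤ) : dividedDiff i (C c) = 0 :=
  dividedDiff_eq_of_mul_eq <| by simp [swapVars]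

theorem dividedDiff_eq_zero {i : ℕ} {f : ZPoly} (h : swapVars i f = f) : dividedDiff i f = 0 :=
  dividedDiff_eq_of_mul_eq <| by rw [h]; ring

theorem swapVars_X_left (i : ℕ) : swapVars i (X i) = X (i + 1) := by simp [swapVars]

theorem swapVars_X_right (i : ℕ) : swapVars i (X (i + 1)) = X i := by simp [swapVars]

theorem swapVars_X_of_ne {i k : ℕ} (h : k ≠ i) (h' : k ≠ i + 1) : swapVars i (X k) = X k := by
  simp [swapVars, Equiv.swap_apply_of_ne_of_ne h h']

theorem swapVars_swapVars (i : ℕ) (f : ZPoly) : swapVars i (swapVars i f) = f := by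
  have : (swapVars i).comp (swapVars i) = AlgHom.id ℤ ZPoly := by
    ext1 k
    simp [swapVars]
  exact DFunLike.congr_fun this f

theorem swapVars_comm {i j : ℕ} (h : i + 1 < j) (f : ZPoly) :
    swapVars i (swapVars j f) = swapVars j (swapVars i f) := by
  have : (swapVars i).comp (swapVars j) = (swapVars j).comp (swapVars i) := by
    ext1 k
    simp only [swapVars, AlgHom.comp_apply, rename_X]
    congr 1
    simp only [Equiv.swap_apply_def]
    split_ifs <;> omega
  exact DFunLike.congr_fun this f

theorem swapVars_braid (i : ℕ) (f : ZPoly) :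
    swapVars i (swapVars (i + 1) (swapVars i f))
      = swapVars (i + 1) (swapVars i (swapVars (i + 1) f)) := by
  have : (swapVars i).comp ((swapVars (i + 1)).comp (swapVars i))
      = (swapVars (i + 1)).comp ((swapVars i).comp (swapVars (i + 1))) := by
    ext1 k
    simp only [swapVars, AlgHom.comp_apply, rename_X]
    congr 1
    simp only [Equiv.swap_apply_def]
    split_ifs <;> omega
  exact DFunLike.congr_fun this f

theorem swapVars_dividedDiff (i : ℕ) (f : ZPoly) :
    swapVars i (dividedDiff i f) = dividedDiff i f := by
  symm
  apply dividedDiff_eq_of_mul_eq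
  have h := congrArg (swapVars i) (dividedDiff_spec i f)
  rw [map_sub, map_mul, map_sub, swapVars_swapVars, swapVars_X_left, swapVars_X_right] at h
  linear_combination -h

theorem dividedDiff_dividedDiff (i : ℕ) (f : ZPoly) : dividedDiff i (dividedDiff i f) = 0 :=
  dividedDiff_eq_zero (swapVars_dividedDiff i f)

theorem dividedDiff_comm {i j : ℕ} (h : i + 1 < j) (f : ZPoly) :
    dividedDiff i (dividedDiff j f) = dividedDiff j (dividedDiff i f) := by
  apply dividedDiff_eq_of_mul_eq
  apply mul_left_cancel₀ (X_sub_X_ne_zero (Nat.succ_ne_self j).symm)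
  have h1 := dividedDiff_spec j f
  have h2 := congrArg (swapVars i) h1
  have h3 := dividedDiff_spec j (dividedDiff i f)
  have h4 := dividedDiff_spec i f
  have h5 := congrArg (swapVars j) h4
  simp only [map_sub, map_mul] at h2 h5
  rw [swapVars_X_of_ne (by omega) (by omega), swapVars_X_of_ne (by omega) (by omega),
    swapVars_comm h] at h2
  rw [swapVars_X_of_ne (by omega) (by omega), swapVars_X_of_ne (by omega) (by omega)] at h5
  linear_combination -h1 + h2 + h4 - h5 + (X i - X (i + 1)) * h3

/-- The braid relation: after multiplication by the three differences of the variables involved,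
both sides are the alternating sum of `f` over the symmetric group on these variables. -/
theorem dividedDiff_braid (i : ℕ) (f : ZPoly) :
    dividedDiff i (dividedDiff (i + 1) (dividedDiff i f))
      = dividedDiff (i + 1) (dividedDiff i (dividedDiff (i + 1) f)) := by
  have e1 := swapVars_X_left i
  have e2 := swapVars_X_right i
  have e3 : swapVars i (X (i + 1 + 1)) = X (i + 1 + 1) := swapVars_X_of_ne (by omega) (by omega)
  have e4 := swapVars_X_left (i + 1)
  have e5 := swapVars_X_right (i + 1)
  have e6 : swapVars (i + 1) (X i) = X i := swapVars_X_of_ne (by omega) (by omega)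
  have ha := dividedDiff_spec i f
  have ha' := dividedDiff_spec (i + 1) f
  set a := dividedDiff i f with hadef
  set a' := dividedDiff (i + 1) f
  have hb := dividedDiff_spec (i + 1) a
  have hb' := dividedDiff_spec i a'
  set b := dividedDiff (i + 1) a
  set b' := dividedDiff i a'
  have hc := dividedDiff_spec i b
  have hc' := dividedDiff_spec (i + 1) b'
  set c := dividedDiff i b
  set c' := dividedDiff (i + 1) b'
  have sa : swapVars i a = a := swapVars_dividedDiff i f
  have sa' : swapVars (i + 1) a' = a' := swapVars_dividedDiff (i + 1) f
  have hb1 := congrArg (swapVars i) hb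
  have hb1' := congrArg (swapVars (i + 1)) hb'
  have ha2 := congrArg (swapVars (i + 1)) ha
  have ha2' := congrArg (swapVars i) ha'
  have ha3 := congrArg (swapVars i) ha2
  have ha3' := congrArg (swapVars (i + 1)) ha2'
  simp only [map_sub, map_mul, e1, e2, e3, e4, e5, e6, sa, sa', swapVars_braid]
    at hb1 hb1' ha2 ha2' ha3 ha3'
  apply mul_left_cancel₀ (X_sub_X_ne_zero (Nat.succ_ne_self i).symm)
  apply mul_left_cancel₀ (X_sub_X_ne_zero (Nat.succ_ne_self (i + 1)).symm)
  apply mul_left_cancel₀ (X_sub_X_ne_zero (show i ≠ i + 1 + 1 by omega))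
  linear_combination
    -(X (i + 1) - X (i + 1 + 1)) * (X i - X (i + 1 + 1)) * hc
      - (X i - X (i + 1 + 1)) * hb + (X (i + 1) - X (i + 1 + 1)) * hb1 - ha + ha2 - ha3
    + (X i - X (i + 1)) * (X i - X (i + 1 + 1)) * hc'
      + (X i - X (i + 1 + 1)) * hb' - (X i - X (i + 1)) * hb1' + ha' - ha2' + ha3'

theorem isHomogeneous_swapVars {i d : ℕ} {f : ZPoly} (hf : f.IsHomogeneous d) :
    (swapVars i f).IsHomogeneous d := hf.rename_isHomogeneous

/-- Divided differences lower the degree by one. -/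
theorem isHomogeneous_dividedDiff {i d : ℕ} {f : ZPoly} (hf : f.IsHomogeneous (d + 1)) :
    (dividedDiff i f).IsHomogeneous d := by
  have hX : ∀ f : ZPoly, f.IsHomogeneous 1 → (dividedDiff i f).IsHomogeneous 0 := by
    intro f hf
    rw [← mem_homogeneousSubmodule, homogeneousSubmodule_one_eq_span_X] at hf
    induction hf using Submodule.span_induction with
    | mem x hx =>
      obtain ⟨k, rfl⟩ := hx
      rcases eq_or_ne k i with rfl | h1
      · rw [dividedDiff_eq_of_mul_eq (g := 1) (by rw [swapVars_X_left]; ring)]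
        exact isHomogeneous_one ..
      · rcases eq_or_ne k (i + 1) with rfl | h2
        · rw [dividedDiff_eq_of_mul_eq (g := C (-1)) (by rw [swapVars_X_right]; simp)]
          exact isHomogeneous_C ..
        · rw [dividedDiff_eq_zero (swapVars_X_of_ne h1 h2)]
          exact isHomogeneous_zero ..
    | zero => rw [← C_0, dividedDiff_C]; exact isHomogeneous_zero ..
    | add x y _ _ hx hy => rw [dividedDiff_add]; exact hx.add hy
    | smul a x _ hx =>
      rw [smul_eq_C_mul, dividedDiff_mul, dividedDiff_C, zero_mul, zero_add]
      simpa [swapVars] using hx.C_mul a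
  suffices H : ∀ (n : ℕ) (f : ZPoly), f ∈ (homogeneousSubmodule ℕ ℤ 1) ^ n →
      ∀ d, n = d + 1 → (dividedDiff i f).IsHomogeneous d by
    refine H (d + 1) f ?_ d rfl
    rwa [homogeneousSubmodule_one_pow]
  intro n f hf
  induction hf using Submodule.pow_induction_on_left' with
  | algebraMap r => intro d hd; omega
  | add x y n _ _ hx hy => intro d hd; rw [dividedDiff_add]; exact (hx d hd).add (hy d hd)
  | mem_mul m hm n x hx ih =>
    intro d hd
    obtain rfl : n = d := by omega
    rw [homogeneousSubmodule_one_pow] at hx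
    rw [dividedDiff_mul]
    refine IsHomogeneous.add (by simpa using (hX m hm).mul hx) ?_
    rcases n with _ | n
    · rw [totalDegree_eq_zero_iff_eq_C.1 ((totalDegree_zero_iff_isHomogeneous (p := x)).2 hx),
        dividedDiff_C, mul_zero]
      exact isHomogeneous_zero ..
    · have := (isHomogeneous_swapVars (i := i) hm).mul (ih n rfl)
      rwa [add_comm 1 n] at this

theorem swapVars_mem_supported {i n : ℕ} (h : i + 1 < n) {f : ZPoly}
    (hf : f ∈ supported ℤ (Set.Iio n)) : swapVars i f ∈ supported ℤ (Set.Iio n) := by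
  rw [supported_eq_adjoin_X] at hf
  induction hf using Algebra.adjoin_induction with
  | mem x hx =>
    obtain ⟨k, hk, rfl⟩ := hx
    simp only [Set.mem_Iio] at hk
    rw [swapVars, rename_X, X_mem_supported, Set.mem_Iio, Equiv.swap_apply_def]
    split_ifs <;> omega
  | algebraMap r => rw [AlgHom.commutes]; exact Subalgebra.algebraMap_mem _ _
  | add x y _ _ hx hy => rw [map_add]; exact add_mem hx hy
  | mul x y _ _ hx hy => rw [map_mul]; exact mul_mem hx hy

theorem dividedDiff_mem_supported {i n : ℕ} (h : i + 1 < n) {f : ZPoly}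
    (hf : f ∈ supported ℤ (Set.Iio n)) : dividedDiff i f ∈ supported ℤ (Set.Iio n) := by
  have hf' := hf
  rw [supported_eq_adjoin_X] at hf'
  induction hf' using Algebra.adjoin_induction with
  | mem x hx =>
    obtain ⟨k, hk, rfl⟩ := hx
    rcases eq_or_ne k i with rfl | h1
    · rw [dividedDiff_eq_of_mul_eq (g := 1) (by rw [swapVars_X_left]; ring)]
      exact one_mem _
    · rcases eq_or_ne k (i + 1) with rfl | h2
      · rw [dividedDiff_eq_of_mul_eq (g := -1) (by rw [swapVars_X_right]; ring)]
        exact neg_mem (one_mem _)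
      · rw [dividedDiff_eq_zero (swapVars_X_of_ne h1 h2)]
        exact zero_mem _
  | algebraMap r => rw [algebraMap_eq, dividedDiff_C]; exact zero_mem _
  | add x y hx hy hx' hy' => rw [dividedDiff_add]; exact add_mem (hx' hx) (hy' hy)
  | mul x y hx hy hx' hy' =>
    rw [dividedDiff_mul]
    exact add_mem (mul_mem (hx' hx) hy) (mul_mem (swapVars_mem_supported h hx) (hy' hy))

/-! ### The operators `R` and `T` -/

theorem bergeronSottile_X (k j : ℕ) : bergeronSottile k (X j)
    = if j < k then X j else if j = k then 0 else X (j - 1) := by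
  simp [bergeronSottile]

theorem bergeronSottile_swapVars (k : ℕ) (f : ZPoly) :
    bergeronSottile k (swapVars k f) = bergeronSottile (k + 1) f := by
  have : (bergeronSottile k).comp (swapVars k) = bergeronSottile (k + 1) := by
    ext1 j
    simp only [swapVars, AlgHom.comp_apply, rename_X, bergeronSottile_X, Equiv.swap_apply_def]
    split_ifs <;> first | omega | rfl | (congr 1; omega)
  exact DFunLike.congr_fun this f

/-- The description `T = (R_{k+1} - R_k) / x_k` of the quasisymmetric divided difference. -/
theorem X_mul_trim (k : ℕ) (f : ZPoly) :
    X k * trim k f = bergeronSottile (k + 1) f - bergeronSottile k f := by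
  have h := congrArg (bergeronSottile k) (dividedDiff_spec k f)
  rw [map_sub, map_mul, map_sub, bergeronSottile_swapVars, bergeronSottile_X, bergeronSottile_X,
    if_neg (lt_irrefl k), if_pos rfl, if_neg (by omega), if_neg (by omega),
    Nat.add_sub_cancel] at h
  rw [trim]
  linear_combination h

theorem trim_eq_of_X_mul_eq {k : ℕ} {f g : ZPoly}
    (h : X k * g = bergeronSottile (k + 1) f - bergeronSottile k f) : trim k f = g :=
  mul_left_cancel₀ (X_ne_zero k) ((X_mul_trim k f).trans h.symm)

theorem trim_add (k : ℕ) (f g : ZPoly) : trim k (f + g) = trim k f + trim k g := by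
  rw [trim, dividedDiff_add, map_add, trim, trim]

/-- The operator `trim k` as a linear map. -/
noncomputable def trimHom (k : ℕ) : ZPoly →ₗ[ℤ] ZPoly :=
  (AddMonoidHom.mk' (trim k) (trim_add k)).toIntLinearMap

theorem trimHom_apply (k : ℕ) (f : ZPoly) : trimHom k f = trim k f := rfl

theorem trim_mul (k : ℕ) (f g : ZPoly) :
    trim k (f * g) = trim k f * bergeronSottile k g + bergeronSottile (k + 1) f * trim k g :=
  trim_eq_of_X_mul_eq <| by
    rw [map_mul, map_mul]
    linear_combination bergeronSottile k g * X_mul_trim k f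
      + bergeronSottile (k + 1) f * X_mul_trim k g

theorem trim_mul' (k : ℕ) (f g : ZPoly) :
    trim k (f * g) = trim k f * bergeronSottile (k + 1) g + bergeronSottile k f * trim k g := by
  rw [mul_comm, trim_mul]; ring

theorem isHomogeneous_trim {k d : ℕ} {f : ZPoly} (hf : f.IsHomogeneous (d + 1)) :
    (trim k f).IsHomogeneous d := by
  have := (isHomogeneous_dividedDiff (i := k) hf).aeval
    (fun j => if j < k then X j else if j = k then 0 else X (j - 1) : ℕ → ZPoly) (n := 1)
    (fun j => by
      split_ifs
      exacts [isHomogeneous_X .., isHomogeneous_zero .., isHomogeneous_X ..])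
  rwa [one_mul] at this

/-! ### The sums `x₀ + ⋯ + x_{m-1}` -/

/-- The linear form `x₀ + ⋯ + x_{m-1}`, the Schubert polynomial of the transposition of the
positions `m - 1` and `m`. -/
noncomputable def varSum (m : ℕ) : ZPoly := ∑ j ∈ Finset.range m, X j

theorem varSum_zero : varSum 0 = 0 := by simp [varSum]

theorem varSum_succ (m : ℕ) : varSum (m + 1) = varSum m + X m := Finset.sum_range_succ ..

theorem bergeronSottile_varSum_of_le {k m : ℕ} (h : m ≤ k) :
    bergeronSottile k (varSum m) = varSum m := by
  rw [varSum, map_sum]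
  refine Finset.sum_congr rfl fun j hj => ?_
  rw [Finset.mem_range] at hj
  rw [bergeronSottile_X, if_pos (by omega)]

theorem bergeronSottile_varSum_succ {k m : ℕ} (h : k ≤ m) :
    bergeronSottile k (varSum (m + 1)) = varSum m := by
  induction m, h using Nat.le_induction with
  | base =>
    rw [varSum_succ, map_add, bergeronSottile_varSum_of_le le_rfl, bergeronSottile_X]
    simp
  | succ m hm ih =>
    rw [varSum_succ, map_add, ih, bergeronSottile_X, if_neg (by omega), if_neg (by omega),
      Nat.add_sub_cancel, varSum_succ]

theorem trim_varSum_self (k : ℕ) : trim k (varSum (k + 1)) = 1 :=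
  trim_eq_of_X_mul_eq <| by
    rw [bergeronSottile_varSum_of_le le_rfl, bergeronSottile_varSum_succ le_rfl, varSum_succ]
    ring

theorem trim_varSum_of_ne {k m : ℕ} (h : m ≠ k + 1) : trim k (varSum m) = 0 :=
  trim_eq_of_X_mul_eq <| by
    rcases Nat.lt_or_gt_of_ne h with h | h
    · rw [bergeronSottile_varSum_of_le (by omega), bergeronSottile_varSum_of_le (by omega)]
      ring
    · obtain ⟨m, rfl⟩ : ∃ r, m = r + 1 := ⟨m - 1, by omega⟩
      rw [bergeronSottile_varSum_succ (by omega), bergeronSottile_varSum_succ (by omega)]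
      ring

/-! ### The functional summing the compositions of the operators `T` -/

/-- The sum of the constant terms of `T_{i₀} ⋯ T_{i_{m-1}} f` over all sequences with `i_j ≤ j`. -/
noncomputable def trimSum : ℕ → ZPoly →ₗ[ℤ] ℤ
  | 0 => lcoeff ℤ 0
  | m + 1 => ∑ k ∈ Finset.range (m + 1), trimSum m ∘ₗ trimHom k

theorem trimSum_zero (f : ZPoly) : trimSum 0 f = constantCoeff f := rfl

theorem trimSum_succ (m : ℕ) (f : ZPoly) :
    trimSum (m + 1) f = ∑ k ∈ Finset.range (m + 1), trimSum m (trim k f) := by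
  simp [trimSum, trimHom_apply]

/-- A positive value of `trimSum` is witnessed by a positive summand. -/
theorem exists_foldr_trim_pos {m : ℕ} {f : ZPoly} (hf : f.IsHomogeneous m)
    (h : 0 < trimSum m f) : ∃ i : Fin m → ℕ, (∀ j, i j ≤ (j : ℕ)) ∧
      ∃ c : ℤ, 0 < c ∧ (List.ofFn i).foldr trim f = C c := by
  induction m generalizing f with
  | zero =>
    refine ⟨Fin.elim0, fun j => j.elim0, constantCoeff f, h, ?_⟩
    rw [List.ofFn_zero, List.foldr_nil]
    exact totalDegree_eq_zero_iff_eq_C.1 ((totalDegree_zero_iff_isHomogeneous ℕ).2 hf)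
  | succ m ih =>
    rw [trimSum_succ] at h
    obtain ⟨k, hk, hpos⟩ := Finset.exists_lt_of_sum_lt (s := Finset.range (m + 1))
      (f := fun _ => (0 : ℤ)) (g := fun k => trimSum m (trim k f))
      (by rwa [Finset.sum_const_zero])
    obtain ⟨i, hi, c, hc, e⟩ := ih (isHomogeneous_trim hf) hpos
    refine ⟨Fin.snoc (α := fun _ => ℕ) i k, fun j => ?_, c, hc, ?_⟩
    · refine Fin.lastCases ?_ (fun j => ?_) j
      · simpa [Nat.lt_succ_iff] using hk
      · simpa using hi j
    · rw [List.ofFn_succ']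
      simpa using e

/-- `trimSum m` vanishes on the multiples of `x₀ + ⋯ + x_m`. -/
theorem trimSum_varSum_succ_mul (m : ℕ) (g : ZPoly) : trimSum m (varSum (m + 1) * g) = 0 := by
  induction m generalizing g with
  | zero => simp [trimSum_zero, varSum_succ, varSum_zero]
  | succ m ih =>
    rw [trimSum_succ]
    refine Finset.sum_eq_zero fun k hk => ?_
    rw [Finset.mem_range] at hk
    rw [trim_mul', trim_varSum_of_ne (by omega), bergeronSottile_varSum_succ (by omega), zero_mul,
      zero_add, ih]

/-- The quadratic form `(x₀ + ⋯ + xᵢ)(xᵢ - xᵢ₊₁)`, one of the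
quadratic relations of Klyachko's presentation of the cohomology of the permutahedral variety. -/
noncomputable def quadForm (i : ℕ) : ZPoly := varSum (i + 1) * (X i - X (i + 1))

theorem trim_quadForm_mul_of_succ_lt {k i : ℕ} (h : k + 1 < i) (g : ZPoly) :
    trim k (quadForm i * g) = quadForm (i - 1) * trim k g := by
  obtain ⟨i, rfl⟩ : ∃ r, i = r + 1 := ⟨i - 1, by omega⟩
  have e : ∀ l, l ≤ k + 1 → bergeronSottile l (quadForm (i + 1)) = quadForm i := fun l hl => by
    rw [quadForm, map_mul, map_sub, bergeronSottile_varSum_succ (by omega), bergeronSottile_X,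
      bergeronSottile_X, if_neg (by omega), if_neg (by omega), if_neg (by omega),
      if_neg (by omega), quadForm, Nat.add_sub_cancel, Nat.add_sub_cancel]
  rw [trim_mul, e _ le_rfl, trim_eq_of_X_mul_eq (g := 0), zero_mul, zero_add, Nat.add_sub_cancel]
  rw [e _ le_rfl, e _ (by omega), mul_zero, sub_self]

theorem trim_quadForm_mul_of_lt {k i : ℕ} (h : i + 1 < k) (g : ZPoly) :
    trim k (quadForm i * g) = quadForm i * trim k g := by
  have e : ∀ l, k ≤ l → bergeronSottile l (quadForm i) = quadForm i := fun l hl => by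
    rw [quadForm, map_mul, map_sub, bergeronSottile_varSum_of_le (by omega), bergeronSottile_X,
      bergeronSottile_X, if_pos (by omega), if_pos (by omega)]
  rw [trim_mul, e _ (by omega), trim_eq_of_X_mul_eq (g := 0), zero_mul, zero_add]
  rw [e _ le_rfl, e _ (by omega), mul_zero, sub_self]

theorem trim_quadForm_self (i : ℕ) (g : ZPoly) : trim i (quadForm i * g)
    = varSum (i + 1) * bergeronSottile (i + 1) g + varSum i * bergeronSottile i g :=
  trim_eq_of_X_mul_eq <| by
    rw [quadForm, map_mul, map_mul, map_mul, map_mul, map_sub, map_sub,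
      bergeronSottile_varSum_of_le le_rfl, bergeronSottile_varSum_succ le_rfl]
    simp only [bergeronSottile_X]
    simp
    ring

theorem trim_quadForm_pred (i : ℕ) (g : ZPoly) : trim i (quadForm (i + 1) * g)
    = quadForm i * trim i g - varSum (i + 1) * bergeronSottile (i + 1) g :=
  trim_eq_of_X_mul_eq <| by
    rw [quadForm, quadForm, map_mul, map_mul, map_mul, map_mul, map_sub, map_sub,
      bergeronSottile_varSum_succ le_rfl, bergeronSottile_varSum_succ (by omega)]
    simp only [bergeronSottile_X]
    simp [show ¬ i + 1 + 1 < i by omega, show i + 1 + 1 ≠ i by omega]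
    linear_combination varSum (i + 1) * (X i - X (i + 1)) * X_mul_trim i g

theorem trim_quadForm_succ (i : ℕ) (g : ZPoly) : trim (i + 1) (quadForm i * g)
    = quadForm i * trim (i + 1) g - varSum (i + 1) * bergeronSottile (i + 1) g :=
  trim_eq_of_X_mul_eq <| by
    rw [quadForm, map_mul, map_mul, map_mul, map_mul, map_sub, map_sub,
      bergeronSottile_varSum_of_le le_rfl, bergeronSottile_varSum_of_le (by omega)]
    simp only [bergeronSottile_X]
    simp
    linear_combination varSum (i + 1) * (X i - X (i + 1)) * X_mul_trim (i + 1) g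

/-- `trimSum m` vanishes on the multiples of the quadratic forms `(x₀ + ⋯ + xᵢ)(xᵢ - xᵢ₊₁)`, `i < m`:
the contributions of `T_{i-1}`, `T_i` and `T_{i+1}` telescope. -/
theorem trimSum_quadForm_mul {m i : ℕ} (hi : i < m) (g : ZPoly) :
    trimSum m (quadForm i * g) = 0 := by
  induction m generalizing i g with
  | zero => omega
  | succ m ih =>
    set A := trimSum m (varSum (i + 1) * bergeronSottile (i + 1) g) with hA
    set B := trimSum m (varSum i * bergeronSottile i g) with hB
    have key : ∀ k ∈ Finset.range (m + 1), trimSum m (trim k (quadForm i * g))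
        = (if k = i then A + B else 0) - (if k = i - 1 then B else 0)
          - (if k = i + 1 then A else 0) := by
      intro k hk
      rw [Finset.mem_range] at hk
      rcases Nat.lt_trichotomy k i with h | rfl | h
      · rw [if_neg (by omega), if_neg (by omega : k ≠ i + 1)]
        rcases Nat.lt_or_ge (k + 1) i with h' | h'
        · rw [if_neg (by omega), trim_quadForm_mul_of_succ_lt h', ih (by omega)]
          rfl
        · obtain rfl : i = k + 1 := by omega
          rw [if_pos (by omega), trim_quadForm_pred, map_sub, ih (by omega), hB]
          ring
      · rw [if_pos rfl, if_neg (by omega : k ≠ k + 1), trim_quadForm_self, map_add]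
        split_ifs with h0
        · -- for `k = 0` the truncated `k - 1` is `k`, but then `B = 0`
          have : B = 0 := by
            rw [hB, show k = 0 by omega, varSum_zero, zero_mul, map_zero]
          linarith
        · ring
      · rw [if_neg (by omega), if_neg (by omega : k ≠ i - 1)]
        rcases Nat.lt_or_ge (i + 1) k with h' | h'
        · rw [if_neg (by omega), trim_quadForm_mul_of_lt h', ih (by omega)]
          rfl
        · obtain rfl : k = i + 1 := by omega
          rw [if_pos rfl, trim_quadForm_succ, map_sub, ih (by omega)]
          ring
    rw [trimSum_succ, Finset.sum_congr rfl key, Finset.sum_sub_distrib, Finset.sum_sub_distrib,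
      Finset.sum_ite_eq', Finset.sum_ite_eq', Finset.sum_ite_eq', if_pos (by simpa using hi),
      if_pos (by rw [Finset.mem_range]; omega)]
    split_ifs with h
    · ring
    · rw [Finset.mem_range] at h
      obtain rfl : i = m := by omega
      have : A = 0 := trimSum_varSum_succ_mul i _
      linarith

/-! ### Positivity on products of the sums `x₀ + ⋯ + x_{a-1}` -/

theorem bergeronSottile_varSum_mem_range (k a : ℕ) :
    bergeronSottile k (varSum a) ∈ Set.range varSum := by
  rcases Nat.lt_or_ge k a with h | h
  · obtain ⟨a, rfl⟩ : ∃ r, a = r + 1 := ⟨a - 1, by omega⟩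
    exact ⟨a, (bergeronSottile_varSum_succ (by omega)).symm⟩
  · exact ⟨a, (bergeronSottile_varSum_of_le h).symm⟩

theorem bergeronSottile_mem_closure {f : ZPoly} (hf : f ∈ Subsemiring.closure (Set.range varSum))
    (k : ℕ) : bergeronSottile k f ∈ Subsemiring.closure (Set.range varSum) := by
  induction hf using Subsemiring.closure_induction with
  | mem x hx =>
    obtain ⟨a, rfl⟩ := hx
    exact Subsemiring.subset_closure (bergeronSottile_varSum_mem_range k a)
  | zero => rw [map_zero]; exact zero_mem _
  | one => rw [map_one]; exact one_mem _
  | add x y _ _ hx hy => rw [map_add]; exact add_mem hx hy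
  | mul x y _ _ hx hy => rw [map_mul]; exact mul_mem hx hy

theorem trim_mem_closure {f : ZPoly} (hf : f ∈ Subsemiring.closure (Set.range varSum))
    (k : ℕ) : trim k f ∈ Subsemiring.closure (Set.range varSum) := by
  induction hf using Subsemiring.closure_induction with
  | mem x hx =>
    obtain ⟨a, rfl⟩ := hx
    rcases eq_or_ne a (k + 1) with rfl | h
    · rw [trim_varSum_self]; exact one_mem _
    · rw [trim_varSum_of_ne h]; exact zero_mem _
  | zero => rw [← trimHom_apply, map_zero]; exact zero_mem _
  | one => rw [trim_eq_of_X_mul_eq (g := 0) (by simp)]; exact zero_mem _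
  | add x y _ _ hx hy => rw [trim_add]; exact add_mem hx hy
  | mul x y hx' hy' hx hy =>
    rw [trim_mul]
    exact add_mem (mul_mem hx (bergeronSottile_mem_closure hy' k))
      (mul_mem (bergeronSottile_mem_closure hx' _) hy)

theorem trimSum_nonneg_of_mem_closure (m : ℕ) {f : ZPoly}
    (hf : f ∈ Subsemiring.closure (Set.range varSum)) : 0 ≤ trimSum m f := by
  induction m generalizing f with
  | zero =>
    rw [trimSum_zero]
    induction hf using Subsemiring.closure_induction with
    | mem x hx => obtain ⟨a, rfl⟩ := hx; simp [varSum]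
    | zero => simp
    | one => simp
    | add x y _ _ hx hy => rw [map_add]; exact add_nonneg hx hy
    | mul x y _ _ hx hy => rw [map_mul]; exact mul_nonneg hx hy
  | succ m ih =>
    rw [trimSum_succ]
    exact Finset.sum_nonneg fun k _ => ih (trim_mem_closure hf k)

theorem prod_varSum_mem_closure (l : List ℕ) :
    (l.map varSum).prod ∈ Subsemiring.closure (Set.range varSum) :=
  list_prod_mem fun x hx => by
    obtain ⟨a, _, rfl⟩ := List.mem_map.1 hx
    exact Subsemiring.subset_closure ⟨a, rfl⟩

theorem bergeronSottile_prod_varSum (k : ℕ) (l : List ℕ) :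
    bergeronSottile k (l.map varSum).prod
      = ((l.map fun b => if k < b then b - 1 else b).map varSum).prod := by
  rw [map_list_prod, List.map_map, List.map_map]
  congr 1
  refine List.map_congr_left fun b _ => ?_
  simp only [Function.comp_apply]
  split_ifs with h
  · obtain ⟨b, rfl⟩ : ∃ r, b = r + 1 := ⟨b - 1, by omega⟩
    exact bergeronSottile_varSum_succ (by omega)
  · exact bergeronSottile_varSum_of_le (by omega)

/-- The positivity of the mixed Eulerian numbers. For a factor `x₀ + ⋯ + x_{a-1}`, the operator
`T_{a-1}` produces a product of `m - 1` such factors with indices in `[1, m - 1]`, plus a polynomial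
with nonnegative coefficients in these sums. -/
theorem trimSum_prod_varSum_pos (m : ℕ) (l : List ℕ) (hl : l.length = m)
    (h : ∀ a ∈ l, 1 ≤ a ∧ a ≤ m) : 0 < trimSum m (l.map varSum).prod := by
  induction m generalizing l with
  | zero =>
    obtain rfl := List.length_eq_zero_iff.1 hl
    simp [trimSum_zero]
  | succ m ih =>
    obtain ⟨a, l, rfl⟩ := List.exists_cons_of_length_eq_add_one hl
    obtain ⟨⟨ha, ham⟩, hl'⟩ := List.forall_mem_cons.1 h
    obtain ⟨a, rfl⟩ : ∃ r, a = r + 1 := ⟨a - 1, by omega⟩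
    have hlen : l.length = m := by simpa using hl
    rw [trimSum_succ]
    refine Finset.sum_pos' (fun k _ => trimSum_nonneg_of_mem_closure m
      (trim_mem_closure (prod_varSum_mem_closure _) k)) ⟨a, Finset.mem_range.2 (by omega), ?_⟩
    rw [List.map_cons, List.prod_cons]
    -- the letters `a + 1` of `l` become `a + 1` or `a`; this choice keeps them in `[1, m]`
    rcases Nat.lt_or_ge a m with h' | h'
    · rw [trim_mul', trim_varSum_self, one_mul, map_add, bergeronSottile_prod_varSum]
      refine add_pos_of_pos_of_nonneg (ih _ (by simpa using hlen) fun b hb => ?_)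
        (trimSum_nonneg_of_mem_closure m (mul_mem (Subsemiring.subset_closure
          (bergeronSottile_varSum_mem_range _ _)) (trim_mem_closure (prod_varSum_mem_closure _) _)))
      obtain ⟨c, hc, rfl⟩ := List.mem_map.1 hb
      have := hl' c hc
      split_ifs <;> omega
    · rw [trim_mul, trim_varSum_self, one_mul, map_add, bergeronSottile_prod_varSum]
      refine add_pos_of_pos_of_nonneg (ih _ (by simpa using hlen) fun b hb => ?_)
        (trimSum_nonneg_of_mem_closure m (mul_mem (Subsemiring.subset_closure
          (bergeronSottile_varSum_mem_range _ _)) (trim_mem_closure (prod_varSum_mem_closure _) _)))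
      obtain ⟨c, hc, rfl⟩ := List.mem_map.1 hb
      have := hl' c hc
      have := List.length_pos_of_mem hc
      split_ifs <;> omega

/-! ### The Euler operator -/

/-- The operator `∑ (x₀ + ⋯ + xᵢ) ∂ᵢ` over `i < m`. -/
noncomputable def eulerOp (m : ℕ) (f : ZPoly) : ZPoly :=
  ∑ i ∈ Finset.range m, varSum (i + 1) * dividedDiff i f

/-- The ideal generated by the quadratic forms `(x₀ + ⋯ + xᵢ)(xᵢ - xᵢ₊₁)`, `i < m`, and by
`x₀ + ⋯ + x_m`. -/
noncomputable def klyachkoIdeal (m : ℕ) : Ideal ZPoly :=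
  Ideal.span (insert (varSum (m + 1)) (quadForm '' Set.Iio m))

theorem trimSum_eq_zero_of_mem_klyachkoIdeal {m : ℕ} {f : ZPoly} (hf : f ∈ klyachkoIdeal m) :
    trimSum m f = 0 := by
  rw [klyachkoIdeal] at hf
  refine Submodule.span_induction (p := fun f _ => ∀ g, trimSum m (f * g) = 0) ?_ ?_ ?_ ?_ hf 1
    |> fun h => by rwa [mul_one] at h
  · rintro f (rfl | ⟨i, hi, rfl⟩) g
    · exact trimSum_varSum_succ_mul m g
    · exact trimSum_quadForm_mul hi g
  · simp
  · intro f g _ _ hf hg p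
    rw [add_mul, map_add, hf, hg, add_zero]
  · intro a f _ hf g
    rw [smul_eq_mul, mul_comm a, mul_assoc, hf]

theorem eulerOp_add (m : ℕ) (f g : ZPoly) : eulerOp m (f + g) = eulerOp m f + eulerOp m g := by
  simp only [eulerOp, dividedDiff_add, mul_add, Finset.sum_add_distrib]

/-- Up to multiples of the quadratic forms, `eulerOp` is a derivation. -/
theorem eulerOp_mul (m : ℕ) (f g : ZPoly) :
    eulerOp m (f * g) - (eulerOp m f * g + f * eulerOp m g) ∈ klyachkoIdeal m := by
  have : eulerOp m (f * g) - (eulerOp m f * g + f * eulerOp m g)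
      = ∑ i ∈ Finset.range m, -(dividedDiff i f * dividedDiff i g) * quadForm i := by
    rw [eulerOp, eulerOp, eulerOp, Finset.sum_mul, Finset.mul_sum, ← Finset.sum_add_distrib,
      ← Finset.sum_sub_distrib]
    refine Finset.sum_congr rfl fun i _ => ?_
    rw [dividedDiff_mul, quadForm]
    linear_combination - varSum (i + 1) * dividedDiff i g * dividedDiff_spec i f
  rw [this]
  refine sum_mem fun i hi => Ideal.mul_mem_left _ _ (Ideal.subset_span (Or.inr ⟨i, ?_, rfl⟩))
  simpa using hi

theorem dividedDiff_X (i k : ℕ) :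
    dividedDiff i (X k) = if k = i then 1 else if k = i + 1 then -1 else 0 := by
  split_ifs with h1 h2
  · subst h1; exact dividedDiff_eq_of_mul_eq (by rw [swapVars_X_left]; ring)
  · subst h2; exact dividedDiff_eq_of_mul_eq (by rw [swapVars_X_right]; ring)
  · exact dividedDiff_eq_zero (swapVars_X_of_ne h1 h2)

theorem eulerOp_X {m k : ℕ} (hk : k < m + 1) : eulerOp m (X k) - X k ∈ klyachkoIdeal m := by
  have e : ∀ i ∈ Finset.range m, varSum (i + 1) * dividedDiff i (X k)
      = (if i = k then varSum (k + 1) else 0) - if i = k - 1 then varSum k else 0 := by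
    intro i _
    rw [dividedDiff_X]
    rcases eq_or_ne k i with rfl | h1
    · rw [if_pos rfl, if_pos rfl]
      split_ifs with h
      · rw [show k = 0 by omega, varSum_zero]; ring
      · ring
    · rw [if_neg h1, if_neg h1.symm]
      rcases eq_or_ne k (i + 1) with rfl | h2
      · rw [if_pos rfl, Nat.add_sub_cancel, if_pos rfl]; ring
      · rw [if_neg h2]
        split_ifs with h
        · rw [show k = 0 by omega, varSum_zero]; ring
        · ring
  rw [eulerOp, Finset.sum_congr rfl e, Finset.sum_sub_distrib, Finset.sum_ite_eq',
    Finset.sum_ite_eq']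
  have h2 : (if k - 1 ∈ Finset.range m then varSum k else 0) = varSum k := by
    split_ifs with h
    · rfl
    · rw [Finset.mem_range] at h
      rw [show k = 0 by omega, varSum_zero]
  rw [h2]
  split_ifs with h
  · rw [varSum_succ, add_sub_cancel_left, sub_self]; exact zero_mem _
  · rw [Finset.mem_range] at h
    obtain rfl : k = m := by omega
    rw [show (0 - varSum k - X k : ZPoly) = -varSum (k + 1) by rw [varSum_succ]; ring]
    exact neg_mem (Ideal.subset_span (Or.inl rfl))

/-- Euler's identity, in countably many variables. -/
theorem mkDerivation_X_of_isHomogeneous {d : ℕ} {f : ZPoly} (hf : f.IsHomogeneous d) :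
    mkDerivation ℤ (X : ℕ → ZPoly) f = (d : ZPoly) * f := by
  rw [← mem_homogeneousSubmodule, ← homogeneousSubmodule_one_pow] at hf
  induction hf using Submodule.pow_induction_on_left' with
  | algebraMap r => simp
  | add x y n _ _ hx hy => rw [map_add, hx, hy, mul_add]
  | mem_mul f hf n x _ ih =>
    rw [homogeneousSubmodule_one_eq_span_X] at hf
    have : mkDerivation ℤ (X : ℕ → ZPoly) f = f := by
      induction hf using Submodule.span_induction with
      | mem x hx => obtain ⟨k, rfl⟩ := hx; exact mkDerivation_X ..
      | zero => exact map_zero _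
      | add x y _ _ hx hy => rw [map_add, hx, hy]
      | smul a x _ hx => rw [Derivation.map_smul, hx]
    rw [Derivation.leibniz, ih, this, smul_eq_mul, smul_eq_mul]
    push_cast
    ring

/-- On homogeneous polynomials, `eulerOp` is multiplication by the degree modulo the ideal. -/
theorem eulerOp_sub_mem {m d : ℕ} {f : ZPoly} (hf : f.IsHomogeneous d)
    (hs : f ∈ supported ℤ (Set.Iio (m + 1))) :
    eulerOp m f - (d : ZPoly) * f ∈ klyachkoIdeal m := by
  rw [← mkDerivation_X_of_isHomogeneous hf]
  rw [supported_eq_adjoin_X] at hs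
  clear hf
  induction hs using Algebra.adjoin_induction with
  | mem x hx =>
    obtain ⟨k, hk, rfl⟩ := hx
    rw [mkDerivation_X]
    exact eulerOp_X hk
  | algebraMap r =>
    rw [Derivation.map_algebraMap, algebraMap_eq, eulerOp]
    simp only [dividedDiff_C, mul_zero, Finset.sum_const_zero, sub_self]
    exact zero_mem _
  | add x y _ _ hx hy =>
    rw [eulerOp_add, map_add, add_sub_add_comm]
    exact add_mem hx hy
  | mul x y _ _ hx hy =>
    rw [Derivation.leibniz, smul_eq_mul, smul_eq_mul]
    have := add_mem (add_mem (eulerOp_mul m x y) (Ideal.mul_mem_right y _ hx))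
      (Ideal.mul_mem_left _ x hy)
    convert this using 1
    ring

/-! ### Permutations and their lengths -/

theorem adjSwap_lt_adjSwap {n i : ℕ} (h : i + 1 < n) {p q : Fin n} (hpq : p < q)
    (hne : ¬((p : ℕ) = i ∧ (q : ℕ) = i + 1)) : adjSwap i h p < adjSwap i h q := by
  simp only [adjSwap, Equiv.swap_apply_def, Fin.ext_iff, Fin.lt_def, apply_ite Fin.val] at *
  split_ifs <;> omega

theorem adjSwap_adjSwap {n i : ℕ} (h : i + 1 < n) (p : Fin n) :
    adjSwap i h (adjSwap i h p) = p := Equiv.swap_apply_self ..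

theorem adjSwap_mul_self {n i : ℕ} (h : i + 1 < n) : adjSwap i h * adjSwap i h = 1 :=
  Equiv.swap_mul_self ..

theorem permLength_mul_adjSwap {n i : ℕ} (w : Equiv.Perm (Fin n)) (h : i + 1 < n)
    (hw : w ⟨i, Nat.lt_of_succ_lt h⟩ < w ⟨i + 1, h⟩) :
    permLength (w * adjSwap i h) = permLength w + 1 := by
  have hl : adjSwap i h ⟨i, Nat.lt_of_succ_lt h⟩ = ⟨i + 1, h⟩ := Equiv.swap_apply_left ..
  have hr : adjSwap i h ⟨i + 1, h⟩ = ⟨i, Nat.lt_of_succ_lt h⟩ := Equiv.swap_apply_right ..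
  set s := adjSwap i h with hs
  set I := Finset.univ.filter fun p : Fin n × Fin n => p.1 < p.2 ∧ w p.2 < w p.1 with hI
  have hmem : ∀ p, p ∈ I ↔ p.1 < p.2 ∧ w p.2 < w p.1 := fun p => by simp [hI]
  have hne : ∀ p ∈ I, ¬((p.1 : ℕ) = i ∧ (p.2 : ℕ) = i + 1) := by
    rintro ⟨p, q⟩ hp ⟨h1, h2⟩
    obtain rfl : p = ⟨i, Nat.lt_of_succ_lt h⟩ := Fin.ext h1
    obtain rfl : q = ⟨i + 1, h⟩ := Fin.ext h2
    exact lt_asymm hw ((hmem _).1 hp).2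
  have key : (Finset.univ.filter fun p : Fin n × Fin n =>
      p.1 < p.2 ∧ (w * s) p.2 < (w * s) p.1)
        = insert (⟨i, Nat.lt_of_succ_lt h⟩, ⟨i + 1, h⟩)
          (I.map (Equiv.prodCongr s s).toEmbedding) := by
    ext ⟨p, q⟩
    rw [Finset.mem_filter]
    simp only [Finset.mem_univ, true_and, Equiv.Perm.mul_apply, Finset.mem_insert,
      Finset.mem_map, Equiv.coe_toEmbedding, Equiv.prodCongr_apply, Prod.map,
      Prod.exists, Prod.mk.injEq]
    constructor
    · rintro ⟨hpq, hlt⟩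
      by_cases hc : (p : ℕ) = i ∧ (q : ℕ) = i + 1
      · exact Or.inl ⟨Fin.ext hc.1, Fin.ext hc.2⟩
      · exact Or.inr ⟨s p, s q, (hmem _).2 ⟨adjSwap_lt_adjSwap h hpq hc, hlt⟩,
          adjSwap_adjSwap h p, adjSwap_adjSwap h q⟩
    · rintro (⟨rfl, rfl⟩ | ⟨p', q', hp, rfl, rfl⟩)
      · rw [hl, hr]
        exact ⟨Nat.lt_succ_self i, hw⟩
      · refine ⟨adjSwap_lt_adjSwap h ((hmem _).1 hp).1 (hne _ hp), ?_⟩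
        rw [hs, adjSwap_adjSwap, adjSwap_adjSwap]
        exact ((hmem _).1 hp).2
  rw [permLength, permLength, key, Finset.card_insert_of_notMem, Finset.card_map]
  simp only [Finset.mem_map, Equiv.coe_toEmbedding, Equiv.prodCongr_apply, Prod.map, Prod.exists,
    Prod.mk.injEq, not_exists, not_and]
  intro p q hp e1 e2
  obtain rfl : p = ⟨i + 1, h⟩ := by rw [← adjSwap_adjSwap h p, ← hs, e1, hl]
  obtain rfl : q = ⟨i, Nat.lt_of_succ_lt h⟩ := by rw [← adjSwap_adjSwap h q, ← hs, e2, hr]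
  exact absurd ((hmem _).1 hp).1 (by simp [Fin.lt_def])

theorem strictAnti_of_forall_not_isAscent {n : ℕ} {w : Equiv.Perm (Fin n)}
    (hw : ¬∃ i, IsAscent w i) : StrictAnti w := by
  rcases n with _ | n
  · exact fun a => a.elim0
  · refine Fin.strictAnti_iff_succ_lt.2 fun i => ?_
    refine lt_of_le_of_ne (not_lt.1 fun h => hw ⟨i, by omega, h⟩) ?_
    exact fun e => absurd (w.injective e) (by simp [Fin.ext_iff])

theorem exists_descent_of_permLength_pos {n : ℕ} {w : Equiv.Perm (Fin n)}
    (hw : 0 < permLength w) :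
    ∃ (i : ℕ) (h : i + 1 < n), w ⟨i + 1, h⟩ < w ⟨i, Nat.lt_of_succ_lt h⟩ := by
  by_contra! hc
  have hmono : StrictMono w := by
    rcases n with _ | n
    · exact fun a => a.elim0
    · refine Fin.strictMono_iff_lt_succ.2 fun i => ?_
      refine lt_of_le_of_ne (hc i (by omega)) ?_
      exact fun e => absurd (w.injective e) (by simp [Fin.ext_iff])
  obtain ⟨p, hp⟩ := Finset.card_pos.1 hw
  rw [Finset.mem_filter] at hp
  exact lt_asymm (hmono hp.2.1) hp.2.2

theorem eq_one_of_permLength_eq_zero {n : ℕ} {w : Equiv.Perm (Fin n)} (hw : permLength w = 0) :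
    w = 1 := by
  have hmono : StrictMono w := by
    intro a b hab
    refine lt_of_le_of_ne (not_lt.1 fun h => ?_) fun e => hab.ne (w.injective e)
    have := Finset.card_eq_zero.1 hw
    exact Finset.notMem_empty (a, b) (this ▸ Finset.mem_filter.2 ⟨Finset.mem_univ _, hab, h⟩)
  have := Subsingleton.elim (hmono.orderIsoOfSurjective _ w.surjective) (OrderIso.refl (Fin n))
  ext1 a
  exact congrArg (fun e : Fin n ≃o Fin n => e a) this

/-! ### Schubert polynomials -/

/-- The monomial `x₀^{n-1} x₁^{n-2} ⋯ x_{n-2}`. -/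
noncomputable def staircaseMonomial (n : ℕ) : ZPoly :=
  ∏ k ∈ Finset.range n, X k ^ (n - 1 - k)

theorem schubert_of_not_exists_isAscent {n : ℕ} {w : Equiv.Perm (Fin n)}
    (hw : ¬∃ i, IsAscent w i) : schubert w = staircaseMonomial n := by
  rw [schubert, dif_neg hw, staircaseMonomial]

theorem exists_schubert_eq_dividedDiff {n : ℕ} {w : Equiv.Perm (Fin n)}
    (hw : ∃ i, IsAscent w i) : ∃ (i : ℕ) (h : i + 1 < n),
      w ⟨i, Nat.lt_of_succ_lt h⟩ < w ⟨i + 1, h⟩ ∧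
        schubert w = dividedDiff i (schubert (w * adjSwap i h)) := by
  classical
  refine ⟨Nat.find hw, (Nat.find_spec hw).1, (Nat.find_spec hw).2, ?_⟩
  rw [schubert, dif_pos hw]

/-- Induction from the longest permutation downwards: a permutation may use the claim for all
permutations obtained from it at an ascent. -/
theorem ascent_induction {n : ℕ} {P : Equiv.Perm (Fin n) → Prop}
    (step : ∀ w, (∀ (i : ℕ) (h : i + 1 < n), w ⟨i, Nat.lt_of_succ_lt h⟩ < w ⟨i + 1, h⟩ →
      P (w * adjSwap i h)) → P w) (w : Equiv.Perm (Fin n)) : P w := by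
  induction hN : ∑ k : Fin n, (k : ℕ) * (w k : ℕ) using Nat.strong_induction_on generalizing w with
  | _ N ih =>
    subst hN
    exact step w fun i h hw => ih _ (sum_mul_adjSwap_lt w i h hw) _ rfl

theorem adjSwap_apply_left {n i : ℕ} (h : i + 1 < n) :
    adjSwap i h ⟨i, Nat.lt_of_succ_lt h⟩ = ⟨i + 1, h⟩ := Equiv.swap_apply_left ..

theorem adjSwap_apply_right {n i : ℕ} (h : i + 1 < n) :
    adjSwap i h ⟨i + 1, h⟩ = ⟨i, Nat.lt_of_succ_lt h⟩ := Equiv.swap_apply_right ..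

theorem adjSwap_apply_of_ne {n i k : ℕ} (h : i + 1 < n) (hk : k < n) (h1 : k ≠ i)
    (h2 : k ≠ i + 1) : adjSwap i h ⟨k, hk⟩ = ⟨k, hk⟩ :=
  Equiv.swap_apply_of_ne_of_ne (by simpa [Fin.ext_iff] using h1) (by simpa [Fin.ext_iff] using h2)

theorem adjSwap_comm {n i j : ℕ} (hij : i + 1 < j) (hi : i + 1 < n) (hj : j + 1 < n) :
    adjSwap i hi * adjSwap j hj = adjSwap j hj * adjSwap i hi := by
  conv_lhs => rw [adjSwap.eq_def j, Equiv.mul_swap_eq_swap_mul]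
  rw [adjSwap_apply_of_ne _ _ (by omega) (by omega), adjSwap_apply_of_ne _ _ (by omega) (by omega),
    adjSwap.eq_def j]

theorem adjSwap_braid {n i : ℕ} (hi : i + 1 < n) (hj : i + 1 + 1 < n) :
    adjSwap i hi * adjSwap (i + 1) hj * adjSwap i hi
      = adjSwap (i + 1) hj * adjSwap i hi * adjSwap (i + 1) hj := by
  have h1 : adjSwap i hi * adjSwap (i + 1) hj
      = Equiv.swap ⟨i, Nat.lt_of_succ_lt hi⟩ ⟨i + 1 + 1, hj⟩ * adjSwap i hi := by
    conv_lhs => rw [adjSwap.eq_def (i + 1), Equiv.mul_swap_eq_swap_mul]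
    rw [adjSwap_apply_right, adjSwap_apply_of_ne _ _ (by omega) (by omega)]
  have h2 : adjSwap (i + 1) hj * adjSwap i hi
      = Equiv.swap ⟨i, Nat.lt_of_succ_lt hi⟩ ⟨i + 1 + 1, hj⟩ * adjSwap (i + 1) hj := by
    conv_lhs => rw [adjSwap.eq_def i, Equiv.mul_swap_eq_swap_mul]
    rw [adjSwap_apply_left, adjSwap_apply_of_ne _ _ (by omega) (by omega)]
  rw [h1, h2, mul_assoc, mul_assoc, adjSwap_mul_self, adjSwap_mul_self]

/-- The recursion for Schubert polynomials holds at every ascent, not only at the first one: two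
ascents are compared through a common permutation further up, by the relations of the divided
differences. -/
theorem schubert_eq_dividedDiff {n : ℕ} (w : Equiv.Perm (Fin n)) (i : ℕ) (hi : i + 1 < n)
    (hwi : w ⟨i, Nat.lt_of_succ_lt hi⟩ < w ⟨i + 1, hi⟩) :
    schubert w = dividedDiff i (schubert (w * adjSwap i hi)) := by
  induction hN : ∑ k : Fin n, (k : ℕ) * (w k : ℕ) using Nat.strong_induction_on
    generalizing w i with
  | _ N IH =>
    subst hN
    have ih := fun (v : Equiv.Perm (Fin n)) h i hi hvi => IH _ h v i hi hvi rfl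
    clear IH
    have key : ∀ (i j : ℕ) (hi : i + 1 < n) (hj : j + 1 < n), i < j →
        w ⟨i, Nat.lt_of_succ_lt hi⟩ < w ⟨i + 1, hi⟩ →
        w ⟨j, Nat.lt_of_succ_lt hj⟩ < w ⟨j + 1, hj⟩ →
        dividedDiff i (schubert (w * adjSwap i hi))
          = dividedDiff j (schubert (w * adjSwap j hj)) := by
      intro i j hi hj hij hwi hwj
      have hi' := sum_mul_adjSwap_lt w i hi hwi
      have hj' := sum_mul_adjSwap_lt w j hj hwj
      rcases Nat.lt_or_ge (i + 1) j with h | h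
      · rw [ih _ hi' j hj, ih _ hj' i hi, dividedDiff_comm h, mul_assoc, mul_assoc,
          adjSwap_comm h]
        · rwa [Equiv.Perm.mul_apply, Equiv.Perm.mul_apply,
            adjSwap_apply_of_ne _ _ (by omega) (by omega),
            adjSwap_apply_of_ne _ _ (by omega) (by omega)]
        · rwa [Equiv.Perm.mul_apply, Equiv.Perm.mul_apply,
            adjSwap_apply_of_ne _ _ (by omega) (by omega),
            adjSwap_apply_of_ne _ _ (by omega) (by omega)]
      · obtain rfl : j = i + 1 := by omega
        have e0 : adjSwap (i + 1) hj ⟨i, Nat.lt_of_succ_lt hi⟩ = ⟨i, Nat.lt_of_succ_lt hi⟩ :=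
          adjSwap_apply_of_ne _ _ (by omega) (by omega)
        have e2 : adjSwap i hi ⟨i + 1 + 1, hj⟩ = ⟨i + 1 + 1, hj⟩ :=
          adjSwap_apply_of_ne _ _ (by omega) (by omega)
        have el := adjSwap_apply_left hi
        have er := adjSwap_apply_right hi
        have el' := adjSwap_apply_left hj
        have er' := adjSwap_apply_right hj
        have a1 : (w * adjSwap i hi) ⟨i + 1, hi⟩ < (w * adjSwap i hi) ⟨i + 1 + 1, hj⟩ := by
          rw [Equiv.Perm.mul_apply, Equiv.Perm.mul_apply, er, e2]
          exact hwi.trans hwj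
        have a2 : (w * adjSwap (i + 1) hj) ⟨i, Nat.lt_of_succ_lt hi⟩
            < (w * adjSwap (i + 1) hj) ⟨i + 1, hi⟩ := by
          rw [Equiv.Perm.mul_apply, Equiv.Perm.mul_apply, el', e0]
          exact hwi.trans hwj
        have b1 : (w * adjSwap i hi * adjSwap (i + 1) hj) ⟨i, Nat.lt_of_succ_lt hi⟩
            < (w * adjSwap i hi * adjSwap (i + 1) hj) ⟨i + 1, hi⟩ := by
          simp only [Equiv.Perm.mul_apply, e0, el', el, e2]
          exact hwj
        have b2 : (w * adjSwap (i + 1) hj * adjSwap i hi) ⟨i + 1, hi⟩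
            < (w * adjSwap (i + 1) hj * adjSwap i hi) ⟨i + 1 + 1, hj⟩ := by
          simp only [Equiv.Perm.mul_apply, er, e0, e2, er']
          exact hwi
        rw [ih _ hi' (i + 1) hj a1, ih _ hj' i hi a2,
          ih _ ((sum_mul_adjSwap_lt _ _ _ a1).trans hi') i hi b1,
          ih _ ((sum_mul_adjSwap_lt _ _ _ a2).trans hj') (i + 1) hj b2, dividedDiff_braid]
        simp only [mul_assoc w, adjSwap_braid hi hj]
    obtain ⟨j, hj, hwj, e⟩ := exists_schubert_eq_dividedDiff ⟨i, hi, hwi⟩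
    rw [e]
    rcases Nat.lt_trichotomy i j with h | rfl | h
    · exact (key i j hi hj h hwi hwj).symm
    · rfl
    · exact key j i hj hi h hwj hwi

theorem dividedDiff_schubert {n : ℕ} (w : Equiv.Perm (Fin n)) (i : ℕ) (hi : i + 1 < n) :
    dividedDiff i (schubert w)
      = if w ⟨i + 1, hi⟩ < w ⟨i, Nat.lt_of_succ_lt hi⟩ then schubert (w * adjSwap i hi) else 0 := by
  split_ifs with h
  · rw [schubert_eq_dividedDiff (w * adjSwap i hi) i hi, mul_assoc, adjSwap_mul_self, mul_one]
    rwa [Equiv.Perm.mul_apply, Equiv.Perm.mul_apply, adjSwap_apply_left, adjSwap_apply_right]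
  · rw [schubert_eq_dividedDiff w i hi, dividedDiff_dividedDiff]
    exact lt_of_le_of_ne (not_lt.1 h) fun e => absurd (w.injective e) (by simp [Fin.ext_iff])

theorem isHomogeneous_staircaseMonomial (n : ℕ) :
    (staircaseMonomial n).IsHomogeneous (∑ k ∈ Finset.range n, (n - 1 - k)) :=
  IsHomogeneous.prod _ _ _ fun k _ => isHomogeneous_X_pow k _

theorem permLength_of_strictAnti {n : ℕ} {w : Equiv.Perm (Fin n)} (hw : StrictAnti w) :
    permLength w = ∑ k ∈ Finset.range n, (n - 1 - k) := by
  have : (Finset.univ.filter fun p : Fin n × Fin n => p.1 < p.2 ∧ w p.2 < w p.1)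
      = ((Finset.univ : Finset (Fin n)).sigma fun a => Finset.Ioi a).map
        (Equiv.sigmaEquivProd (Fin n) (Fin n)).toEmbedding := by
    ext ⟨a, b⟩
    rw [Finset.mem_filter]
    constructor
    · rintro ⟨-, h, -⟩
      exact Finset.mem_map.2 ⟨⟨a, b⟩, by simpa using h, rfl⟩
    · intro h
      obtain ⟨⟨c, d⟩, hc, e⟩ := Finset.mem_map.1 h
      obtain ⟨rfl, rfl⟩ := Prod.mk.inj e
      have hcd : c < d := by simpa using hc
      exact ⟨Finset.mem_univ _, hcd, hw hcd⟩
  rw [permLength, this, Finset.card_map, Finset.card_sigma,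
    ← Fin.sum_univ_eq_sum_range fun k => n - 1 - k]
  simp

theorem isHomogeneous_schubert {n : ℕ} (w : Equiv.Perm (Fin n)) :
    (schubert w).IsHomogeneous (permLength w) := by
  induction w using ascent_induction with
  | step w ih =>
    by_cases hw : ∃ i, IsAscent w i
    · obtain ⟨i, hi, hwi⟩ := hw
      have := ih i hi hwi
      rw [permLength_mul_adjSwap w hi hwi] at this
      rw [schubert_eq_dividedDiff w i hi hwi]
      exact isHomogeneous_dividedDiff this
    · rw [schubert_of_not_exists_isAscent hw,
        permLength_of_strictAnti (strictAnti_of_forall_not_isAscent hw)]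
      exact isHomogeneous_staircaseMonomial n

theorem schubert_mem_supported {n : ℕ} (w : Equiv.Perm (Fin n)) :
    schubert w ∈ supported ℤ (Set.Iio n) := by
  induction w using ascent_induction with
  | step w ih =>
    by_cases hw : ∃ i, IsAscent w i
    · obtain ⟨i, hi, hwi⟩ := hw
      rw [schubert_eq_dividedDiff w i hi hwi]
      exact dividedDiff_mem_supported hi (ih i hi hwi)
    · rw [schubert_of_not_exists_isAscent hw]
      exact prod_mem fun k hk => pow_mem (X_mem_supported.2 (by simpa using hk)) _

/-- The staircase monomial of `n + 1` with the exponents of the first `k` variables lowered by one.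
For `1 ≤ k ≤ n` it is symmetric in the variables `k - 1` and `k`. -/
noncomputable def loweredStaircase (n k : ℕ) : ZPoly :=
  ∏ j ∈ Finset.range (n + 1), X j ^ (if j < k then n - 1 - j else n - j)

theorem dividedDiff_loweredStaircase {n k : ℕ} (hk : k < n) :
    dividedDiff k (loweredStaircase n k) = loweredStaircase n (k + 1) := by
  have h1 : loweredStaircase n k = X k * loweredStaircase n (k + 1) := by
    rw [loweredStaircase, loweredStaircase,
      ← Finset.mul_prod_erase _ _ (Finset.mem_range.2 (by omega : k < n + 1)),
      ← Finset.mul_prod_erase (Finset.range (n + 1))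
        (fun j => (X j : ZPoly) ^ (if j < k + 1 then n - 1 - j else n - j))
        (Finset.mem_range.2 (by omega : k < n + 1)), ← mul_assoc, if_neg (lt_irrefl k),
      if_pos (Nat.lt_succ_self k), ← pow_succ', show n - 1 - k + 1 = n - k by omega]
    congr 1
    refine Finset.prod_congr rfl fun j hj => ?_
    have := Finset.ne_of_mem_erase hj
    congr 1
    split_ifs <;> omega
  have h2 : swapVars k (loweredStaircase n (k + 1)) = loweredStaircase n (k + 1) := by
    rw [loweredStaircase, map_prod]
    simp only [swapVars, map_pow, rename_X]
    refine Finset.prod_equiv (Equiv.swap k (k + 1)) (fun j => ?_) fun j _ => ?_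
    · rw [Finset.mem_range, Finset.mem_range, Equiv.swap_apply_def]
      split_ifs <;> omega
    · congr 1
      rw [Equiv.swap_apply_def]
      split_ifs <;> omega
  apply dividedDiff_eq_of_mul_eq
  rw [h1, map_mul, h2, swapVars_X_left]
  ring

/-- A composite of divided differences in the variables `x₀, …, x_{n-1}` takes the staircase
monomial to `1`. -/
theorem exists_foldr_dividedDiff_staircaseMonomial (n : ℕ) :
    ∃ L : List ℕ, (∀ i ∈ L, i + 1 < n) ∧ L.foldr dividedDiff (staircaseMonomial n) = 1 := by
  induction n with
  | zero => exact ⟨[], by simp, by simp [staircaseMonomial]⟩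
  | succ n ih =>
    -- one pass `∂_{n-1} ⋯ ∂₀` takes the staircase monomial of `n + 1` to that of `n`
    have H : ∀ k ≤ n, ∃ L : List ℕ, (∀ i ∈ L, i + 1 < n + 1) ∧
        L.foldr dividedDiff (staircaseMonomial (n + 1)) = loweredStaircase n k := by
      intro k hk
      induction k with
      | zero => exact ⟨[], by simp, by simp [staircaseMonomial, loweredStaircase]⟩
      | succ k ihk =>
        obtain ⟨L, hL, e⟩ := ihk (by omega)
        refine ⟨k :: L, List.forall_mem_cons.2 ⟨by omega, hL⟩, ?_⟩
        rw [List.foldr_cons, e, dividedDiff_loweredStaircase (by omega)]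
    obtain ⟨L, hL, e⟩ := H n le_rfl
    obtain ⟨L', hL', e'⟩ := ih
    have e2 : loweredStaircase n n = staircaseMonomial n := by
      rw [loweredStaircase, Finset.prod_range_succ, staircaseMonomial, if_neg (lt_irrefl n),
        Nat.sub_self, pow_zero, mul_one]
      refine Finset.prod_congr rfl fun j hj => ?_
      rw [if_pos (Finset.mem_range.1 hj)]
    refine ⟨L' ++ L, fun i hi => ?_, ?_⟩
    · rcases List.mem_append.1 hi with h | h
      · have := hL' i h
        omega
      · exact hL i h
    · rw [List.foldr_append, e, e2, e']

theorem foldr_dividedDiff_schubert {n : ℕ} (w : Equiv.Perm (Fin n)) (L : List ℕ)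
    (hL : ∀ i ∈ L, i + 1 < n) : L.foldr dividedDiff (schubert w) = 0 ∨
      ∃ v : Equiv.Perm (Fin n), L.foldr dividedDiff (schubert w) = schubert v := by
  induction L with
  | nil => exact Or.inr ⟨w, rfl⟩
  | cons i L ih =>
    obtain ⟨hi, hL⟩ := List.forall_mem_cons.1 hL
    rw [List.foldr_cons]
    rcases ih hL with h | ⟨v, h⟩
    · rw [h, ← C_0, dividedDiff_C]; simp
    · rw [h, dividedDiff_schubert v i hi]
      split_ifs
      exacts [Or.inr ⟨_, rfl⟩, Or.inl rfl]

/-- The Schubert polynomial of the identity is `1`: some composite of divided differences takes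
`𝔖_{w₀}` to `1`, which is therefore a Schubert polynomial, of a permutation of length `0`. -/
theorem schubert_one (n : ℕ) : schubert (1 : Equiv.Perm (Fin n)) = 1 := by
  obtain ⟨L, hL, e⟩ := exists_foldr_dividedDiff_staircaseMonomial n
  -- the longest permutation has no ascent
  have h0 : ¬∃ i, IsAscent (Fin.revPerm : Equiv.Perm (Fin n)) i := by
    rintro ⟨i, hi, h⟩
    simp [Fin.lt_def] at h
    omega
  rw [← schubert_of_not_exists_isAscent h0] at e
  rcases foldr_dividedDiff_schubert Fin.revPerm L hL with h | ⟨v, h⟩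
  · exact absurd (h.symm.trans e) zero_ne_one
  · have hv : schubert v = 1 := h.symm.trans e
    have hlen : permLength v = 0 := by
      have hh := isHomogeneous_schubert v
      rw [hv] at hh
      exact hh.inj_right (isHomogeneous_one ..) one_ne_zero
    rwa [eq_one_of_permLength_eq_zero hlen] at hv

/-! ### Positivity on Schubert polynomials -/

/-- Modulo the Klyachko ideal, `ℓ(w) 𝔖_w` is the sum of `(x₀ + ⋯ + xᵢ) 𝔖_{w sᵢ}` over the descents
`i` of `w`. This reduces the positivity to that of the mixed Eulerian numbers. -/
theorem trimSum_prod_varSum_mul_schubert_pos {m : ℕ} (w : Equiv.Perm (Fin (m + 1))) (l : List ℕ)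
    (hl : l.length + permLength w = m) (h : ∀ a ∈ l, 1 ≤ a ∧ a ≤ m) :
    0 < trimSum m ((l.map varSum).prod * schubert w) := by
  induction hd : permLength w generalizing w l with
  | zero =>
    rw [eq_one_of_permLength_eq_zero hd, schubert_one, mul_one]
    exact trimSum_prod_varSum_pos m l (by omega) h
  | succ d ih =>
    have e : trimSum m ((l.map varSum).prod * eulerOp m (schubert w))
        = (permLength w : ℤ) * trimSum m ((l.map varSum).prod * schubert w) := by
      have h1 := trimSum_eq_zero_of_mem_klyachkoIdeal (Ideal.mul_mem_left _ (l.map varSum).prod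
        (eulerOp_sub_mem (m := m) (isHomogeneous_schubert w) (schubert_mem_supported w)))
      rw [mul_sub, map_sub, sub_eq_zero] at h1
      rw [h1, mul_left_comm, ← nsmul_eq_mul, map_nsmul, nsmul_eq_mul]
    have step : ∀ (i : ℕ) (hi : i + 1 < m + 1),
        w ⟨i + 1, hi⟩ < w ⟨i, Nat.lt_of_succ_lt hi⟩ → 0 < trimSum m
          ((l.map varSum).prod * (varSum (i + 1) * dividedDiff i (schubert w))) := by
      intro i hi hw
      have hlen := permLength_mul_adjSwap (w * adjSwap i hi) hi (by
        rwa [Equiv.Perm.mul_apply, Equiv.Perm.mul_apply, adjSwap_apply_left, adjSwap_apply_right])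
      rw [mul_assoc, adjSwap_mul_self, mul_one] at hlen
      rw [dividedDiff_schubert w i hi, if_pos hw]
      have := ih (w * adjSwap i hi) ((i + 1) :: l) (by rw [List.length_cons]; omega)
        (List.forall_mem_cons.2 ⟨by omega, h⟩) (by omega)
      rwa [List.map_cons, List.prod_cons, mul_comm (varSum (i + 1)), mul_assoc] at this
    have pos : 0 < trimSum m ((l.map varSum).prod * eulerOp m (schubert w)) := by
      rw [eulerOp, Finset.mul_sum, map_sum]
      obtain ⟨i, hi, hw⟩ := exists_descent_of_permLength_pos (w := w) (by omega)
      refine Finset.sum_pos' (fun j hj => ?_) ⟨i, Finset.mem_range.2 (by omega), step i hi hw⟩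
      rw [Finset.mem_range] at hj
      by_cases hwj : w ⟨j + 1, by omega⟩ < w ⟨j, by omega⟩
      · exact (step j (by omega) hwj).le
      · rw [dividedDiff_schubert w j (by omega), if_neg hwj, mul_zero, mul_zero, map_zero]
    rw [e] at pos
    exact pos_of_mul_pos_right pos (by positivity)

/-! ### Divided symmetrizations evaluated at points -/

theorem extendPerm_val {n : ℕ} (σ : Equiv.Perm (Fin n)) (i : Fin n) :
    extendPerm σ i = (σ i : ℕ) :=
  Equiv.Perm.extendDomain_apply_image σ Fin.equivSubtype i

theorem extendPerm_of_le {n j : ℕ} (σ : Equiv.Perm (Fin n)) (h : n ≤ j) : extendPerm σ j = j :=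
  Equiv.Perm.extendDomain_apply_not_subtype σ Fin.equivSubtype (not_lt.2 h)

theorem extendPerm_mul {n : ℕ} (σ τ : Equiv.Perm (Fin n)) :
    extendPerm (σ * τ) = extendPerm σ * extendPerm τ :=
  (Equiv.Perm.extendDomain_mul _ σ τ).symm

theorem extendPerm_swap {n : ℕ} (i j : Fin n) :
    extendPerm (Equiv.swap i j) = Equiv.swap (i : ℕ) j := by
  ext k
  rcases Nat.lt_or_ge k n with hk | hk
  · rw [show k = ((⟨k, hk⟩ : Fin n) : ℕ) from rfl, extendPerm_val, Equiv.swap_apply_def,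
      Equiv.swap_apply_def]
    simp only [Fin.ext_iff, apply_ite Fin.val]
  · rw [extendPerm_of_le _ hk, Equiv.swap_apply_of_ne_of_ne (by omega) (by omega)]

section

variable {K : Type*} [Field K]

/-- The divided symmetrization of `f` in the first `n` variables, evaluated at the point `a`. -/
noncomputable def dividedSymmAt (n : ℕ) (f : ZPoly) (a : ℕ → K) : K :=
  ∑ σ : Equiv.Perm (Fin n), aeval (fun j => a (extendPerm σ j)) f /
    ∏ k ∈ Finset.range (n - 1), (a (extendPerm σ k) - a (extendPerm σ (k + 1)))

theorem map_rename_eq_aeval (φ : ZPoly →+* K) (e : ℕ → ℕ) (f : ZPoly) :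
    φ (rename e f) = aeval (fun j => φ (X (e j))) f := by
  have : φ.comp (rename e : ZPoly →ₐ[ℤ] ZPoly).toRingHom
      = (aeval fun j => φ (X (e j)) : ZPoly →ₐ[ℤ] K).toRingHom :=
    ringHom_ext (by simp) (by simp)
  exact DFunLike.congr_fun this f

theorem dividedSymm_eq_dividedSymmAt (n : ℕ) (f : ZPoly) :
    dividedSymm n f = dividedSymmAt n f fun j => algebraMap ZPoly (FractionRing ZPoly) (X j) := by
  refine Finset.sum_congr rfl fun σ _ => ?_
  congr 1
  · exact map_rename_eq_aeval _ _ f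
  · rw [map_prod]
    simp only [map_sub]

/-! ### Divisibility by the Vandermonde determinant -/

/-- The identification of the variable `x_i` with `x_j`. -/
noncomputable def identifyVars (i j : ℕ) : ZPoly →ₐ[ℤ] ZPoly :=
  rename fun k => if k = i then j else k

theorem X_sub_X_dvd_iff {i j : ℕ} (p : ZPoly) :
    (X j - X i : ZPoly) ∣ p ↔ identifyVars i j p = 0 := by
  constructor
  · rintro ⟨q, rfl⟩
    rw [map_mul, map_sub, identifyVars, rename_X, rename_X, if_pos rfl]
    split_ifs <;> simp
  · intro h
    suffices H : ∀ p : ZPoly, (X j - X i : ZPoly) ∣ identifyVars i j p - p by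
      simpa [h] using H p
    intro p
    induction p using MvPolynomial.induction_on with
    | C a => simp [identifyVars]
    | add p q hp hq =>
      rw [map_add, add_sub_add_comm]
      exact dvd_add hp hq
    | mul_X p k hp =>
      have e : identifyVars i j (p * X k) - p * X k
          = (identifyVars i j p - p) * identifyVars i j (X k)
            + p * (identifyVars i j (X k) - X k) := by
        rw [map_mul]; ring
      rw [e]
      refine dvd_add (hp.mul_right _) (Dvd.dvd.mul_left ?_ _)
      rw [identifyVars, rename_X]
      split_ifs with hk
      · rw [hk]
      · simp

theorem prime_X_sub_X {i j : ℕ} (h : i ≠ j) : Prime (X j - X i : ZPoly) := by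
  refine ⟨X_sub_X_ne_zero h.symm, fun hu => ?_, fun p q hpq => ?_⟩
  · have := (X_sub_X_dvd_iff 1).1 (isUnit_iff_dvd_one.1 hu)
    rw [map_one] at this
    exact one_ne_zero this
  · rw [X_sub_X_dvd_iff, map_mul, mul_eq_zero] at hpq
    rwa [X_sub_X_dvd_iff, X_sub_X_dvd_iff]

theorem X_sub_X_dvd_of_rename_swap {i j : ℕ} {p : ZPoly}
    (hp : rename (Equiv.swap i j) p = -p) : (X j - X i : ZPoly) ∣ p := by
  rw [X_sub_X_dvd_iff]
  have h : identifyVars i j (rename (Equiv.swap i j) p) = identifyVars i j p := by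
    rw [identifyVars, rename_rename]
    congr 2
    ext k
    simp only [Function.comp_apply, Equiv.swap_apply_def]
    split_ifs <;> simp_all
  rw [hp, map_neg] at h
  exact self_eq_neg.1 h.symm

/-- The Vandermonde determinant of the first `n` variables. -/
noncomputable def vandermondePoly (n : ℕ) : ZPoly :=
  (Matrix.vandermonde fun i : Fin n => (X (i : ℕ) : ZPoly)).det

theorem vandermondePoly_eq_prod (n : ℕ) :
    vandermondePoly n = ∏ p ∈ (Finset.univ : Finset (Fin n)).sigma fun i => Finset.Ioi i,
      (X (p.2 : ℕ) - X (p.1 : ℕ) : ZPoly) := by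
  rw [vandermondePoly, Matrix.det_vandermonde, Finset.prod_sigma]

theorem aeval_vandermondePoly {A : Type*} [CommRing A] (n : ℕ) (a : ℕ → A) :
    aeval a (vandermondePoly n) = (Matrix.vandermonde fun i : Fin n => a i).det := by
  rw [vandermondePoly_eq_prod, Matrix.det_vandermonde, map_prod, Finset.prod_sigma]
  simp

theorem aeval_extendPerm_vandermondePoly {A : Type*} [CommRing A] {n : ℕ}
    (σ : Equiv.Perm (Fin n)) (a : ℕ → A) :
    aeval (fun j => a (extendPerm σ j)) (vandermondePoly n)
      = ((Equiv.Perm.sign σ : ℤ) : A) * aeval a (vandermondePoly n) := by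
  rw [aeval_vandermondePoly, aeval_vandermondePoly, ← Matrix.det_permute]
  congr 1
  ext i j
  simp [Matrix.vandermonde_apply, extendPerm_val]

theorem vandermondePoly_ne_zero (n : ℕ) : vandermondePoly n ≠ 0 :=
  Matrix.det_vandermonde_ne_zero_iff.2 fun _ _ h => Fin.ext (X_injective h)

theorem vandermondePoly_dvd {n : ℕ} {p : ZPoly}
    (hp : ∀ σ : Equiv.Perm (Fin n), rename (extendPerm σ) p = (Equiv.Perm.sign σ : ℤ) • p) :
    vandermondePoly n ∣ p := by
  rw [vandermondePoly_eq_prod]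
  refine Finset.prod_dvd_of_isRelPrime ?_ ?_
  · rintro ⟨i, j⟩ hij ⟨k, l⟩ hkl hne
    have hij : i < j := by simpa using hij
    have hkl : k < l := by simpa using hkl
    refine (prime_X_sub_X (by simpa [Fin.ext_iff] using hij.ne)).irreducible.isRelPrime_iff_not_dvd.2
      fun hd => ?_
    rw [X_sub_X_dvd_iff, map_sub, identifyVars, rename_X, rename_X, sub_eq_zero] at hd
    have hd := X_injective hd
    dsimp only at hd
    apply hne
    rw [Fin.lt_def] at hij hkl
    have : k = i ∧ l = j := by
      simp only [Fin.ext_iff]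
      split_ifs at hd <;> omega
    obtain ⟨rfl, rfl⟩ := this
    rfl
  · rintro ⟨i, j⟩ hij
    have hij : i < j := by simpa using hij
    apply X_sub_X_dvd_of_rename_swap
    rw [← extendPerm_swap, hp, Equiv.Perm.sign_swap hij.ne]
    simp

/-- The product of the denominators `x_k - x_{k+1}`. -/
noncomputable def consecutiveProd (n : ℕ) : ZPoly :=
  ∏ k ∈ Finset.range (n - 1), (X k - X (k + 1))

theorem consecutiveProd_dvd_vandermondePoly (n : ℕ) : consecutiveProd n ∣ vandermondePoly n := by
  rcases n with _ | m
  · simp [consecutiveProd]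
  · rw [consecutiveProd, vandermondePoly, Matrix.det_vandermonde, Fin.prod_univ_castSucc,
      Nat.add_sub_cancel, Finset.prod_range]
    refine Dvd.dvd.mul_right (Finset.prod_dvd_prod_of_dvd _ _ fun i _ => ?_) _
    have h := Finset.dvd_prod_of_mem (fun j : Fin (m + 1) => (X (j : ℕ) - X (i : ℕ) : ZPoly))
      (Finset.mem_Ioi.2 i.castSucc_lt_succ)
    rw [← neg_sub, neg_dvd]
    exact h

theorem isHomogeneous_consecutiveProd (n : ℕ) : (consecutiveProd n).IsHomogeneous (n - 1) := by
  have := IsHomogeneous.prod (Finset.range (n - 1)) (fun k => (X k - X (k + 1) : ZPoly))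
    (fun _ => 1) fun k _ => (isHomogeneous_X _ k).sub (isHomogeneous_X _ (k + 1))
  rwa [Finset.sum_const, Finset.card_range, smul_eq_mul, mul_one] at this

/-- The divided symmetrization of a homogeneous polynomial of degree `n - 1` is an integer. After
multiplication by the Vandermonde determinant it becomes an alternating polynomial, so that the
quotient by this determinant is a polynomial, and its degree is `0`. -/
theorem exists_dividedSymmAt_eq_intCast {n : ℕ} {f : ZPoly} (hf : f.IsHomogeneous (n - 1)) :
    ∃ c : ℤ, ∀ a : ℕ → K, Set.InjOn a (Set.Iio n) → dividedSymmAt n f a = (c : K) := by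
  obtain ⟨Q, hQ⟩ := consecutiveProd_dvd_vandermondePoly n
  set N : ZPoly := ∑ σ : Equiv.Perm (Fin n),
    (Equiv.Perm.sign σ : ℤ) • rename (extendPerm σ) (f * Q) with hN
  have hPQ : consecutiveProd n * Q ≠ 0 := hQ ▸ vandermondePoly_ne_zero n
  obtain ⟨q, hq⟩ : vandermondePoly n ∣ N := by
    refine vandermondePoly_dvd fun τ => ?_
    rw [hN, map_sum, Finset.smul_sum]
    refine Fintype.sum_equiv (Equiv.mulLeft τ) _ _ fun σ => ?_
    rw [Equiv.coe_mulLeft, map_zsmul, rename_rename, smul_smul, Equiv.Perm.sign_mul,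
      extendPerm_mul, Units.val_mul, ← mul_assoc, ← Units.val_mul, Int.units_mul_self,
      Units.val_one, one_mul, Equiv.Perm.coe_mul]
  have hdeg : q.totalDegree = 0 := by
    rcases eq_or_ne q 0 with rfl | hq0
    · exact totalDegree_zero
    have h1 := congrArg totalDegree hq
    rw [totalDegree_mul_of_isDomain (vandermondePoly_ne_zero n) hq0, hQ,
      totalDegree_mul_of_isDomain (left_ne_zero_of_mul hPQ) (right_ne_zero_of_mul hPQ),
      (isHomogeneous_consecutiveProd n).totalDegree (left_ne_zero_of_mul hPQ)] at h1
    have h2 : N.totalDegree ≤ n - 1 + Q.totalDegree := by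
      refine totalDegree_finsetSum_le fun σ _ => (totalDegree_smul_le _ _).trans ?_
      refine (totalDegree_rename_le _ _).trans ((totalDegree_mul _ _).trans ?_)
      exact Nat.add_le_add_right hf.totalDegree_le _
    omega
  refine ⟨coeff 0 q, fun a ha => ?_⟩
  have hV : aeval a (vandermondePoly n) ≠ 0 := by
    rw [aeval_vandermondePoly]
    exact Matrix.det_vandermonde_ne_zero_iff.2 fun i j h => Fin.ext (ha i.2 j.2 h)
  have hNa := congrArg (aeval a) hq
  rw [map_mul, totalDegree_eq_zero_iff_eq_C.1 hdeg, aeval_C, hN, map_sum] at hNa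
  rw [← mul_left_inj' hV, mul_comm ((coeff 0 q : ℤ) : K)]
  refine Eq.trans ?_ hNa
  rw [dividedSymmAt, Finset.sum_mul]
  refine Finset.sum_congr rfl fun σ _ => ?_
  have hP : aeval (fun j => a (extendPerm σ j)) (consecutiveProd n)
      = ∏ k ∈ Finset.range (n - 1), (a (extendPerm σ k) - a (extendPerm σ (k + 1))) := by
    simp [consecutiveProd]
  have h3 := aeval_extendPerm_vandermondePoly σ a
  have hs : ((Equiv.Perm.sign σ : ℤ) : K) * ((Equiv.Perm.sign σ : ℤ) : K) = 1 := by
    rw [← Int.cast_mul, ← Units.val_mul, Int.units_mul_self]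
    simp
  rw [← hP, map_zsmul, aeval_rename, map_mul, zsmul_eq_mul]
  rw [hQ, map_mul, ← hQ] at h3
  have hP0 : aeval (fun j => a (extendPerm σ j)) (consecutiveProd n) ≠ 0 := by
    refine left_ne_zero_of_mul (b := aeval (fun j => a (extendPerm σ j)) Q) ?_
    rw [h3]
    exact mul_ne_zero (left_ne_zero_of_mul_eq_one hs) hV
  rw [div_mul_eq_mul_div, div_eq_iff hP0]
  change _ = _ * (aeval (fun j => a (extendPerm σ j)) f * aeval (fun j => a (extendPerm σ j)) Q) * _
  linear_combination (-(aeval (fun j => a (extendPerm σ j)) f) * aeval a (vandermondePoly n)) * hs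
    - (aeval (fun j => a (extendPerm σ j)) f) * (Equiv.Perm.sign σ : ℤ) * h3

/-! ### The recursion for divided symmetrizations -/

/-- The sequence `z` with `0` inserted in position `k`. -/
def insertZero (k : ℕ) (z : ℕ → K) (j : ℕ) : K :=
  if j < k then z j else if j = k then 0 else z (j - 1)

theorem aeval_insertZero (k : ℕ) (z : ℕ → K) (f : ZPoly) :
    aeval (insertZero k z) f = aeval z (bergeronSottile k f) := by
  have : aeval (insertZero k z) = (aeval z).comp (bergeronSottile k) := by
    ext1 j
    rw [AlgHom.comp_apply, aeval_X, bergeronSottile_X, insertZero]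
    split_ifs <;> simp
  exact DFunLike.congr_fun this f

theorem insertZero_of_lt {k j : ℕ} (z : ℕ → K) (h : j < k) : insertZero k z j = z j := if_pos h

theorem insertZero_self (k : ℕ) (z : ℕ → K) : insertZero k z k = 0 := by simp [insertZero]

theorem insertZero_succ {k j : ℕ} (z : ℕ → K) (h : k ≤ j) : insertZero k z (j + 1) = z j := by
  rw [insertZero, if_neg (by omega), if_neg (by omega), Nat.add_sub_cancel]

theorem prod_insertZero_zero (z : ℕ → K) (p : ℕ) :
    ∏ j ∈ Finset.range (p + 1), (insertZero 0 z j - insertZero 0 z (j + 1))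
      = -z 0 * ∏ j ∈ Finset.range p, (z j - z (j + 1)) := by
  rw [Finset.prod_range_succ', insertZero_self, insertZero_succ z le_rfl, zero_sub, mul_comm]
  simp only [insertZero_succ z (Nat.zero_le _)]

theorem prod_insertZero_of_le (z : ℕ → K) (p : ℕ) :
    ∏ j ∈ Finset.range (p + 1), (insertZero (p + 1) z j - insertZero (p + 1) z (j + 1))
      = z p * ∏ j ∈ Finset.range p, (z j - z (j + 1)) := by
  rw [Finset.prod_range_succ, insertZero_self, insertZero_of_lt z (Nat.lt_succ_self p), sub_zero,
    mul_comm]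
  congr 1
  refine Finset.prod_congr rfl fun j hj => ?_
  rw [Finset.mem_range] at hj
  rw [insertZero_of_lt z (by omega), insertZero_of_lt z (by omega)]

theorem prod_insertZero_succ (z : ℕ → K) {k p : ℕ} (h : k < p) :
    (∏ j ∈ Finset.range (p + 1), (insertZero (k + 1) z j - insertZero (k + 1) z (j + 1)))
        * (z k - z (k + 1))
      = -(z k * z (k + 1)) * ∏ j ∈ Finset.range p, (z j - z (j + 1)) := by
  induction p, h using Nat.le_induction with
  | base =>
    rw [Finset.prod_range_succ, prod_insertZero_of_le, insertZero_self,
      insertZero_succ z le_rfl, Finset.prod_range_succ]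
    ring
  | succ p hp ih =>
    rw [Finset.prod_range_succ _ (p + 1), insertZero_succ z hp, insertZero_succ z (by omega),
      Finset.prod_range_succ (fun j => z j - z (j + 1)) p]
    linear_combination (z p - z (p + 1)) * ih

/-- A summation by parts: the partial fraction expansion in the position of the inserted `0`. -/
theorem sum_div_prod_insertZero (z F : ℕ → K) (p : ℕ) (h0 : ∀ j, z j ≠ 0)
    (hne : ∀ j, z j ≠ z (j + 1)) :
    ∑ k ∈ Finset.range (p + 2), F k /
        ∏ j ∈ Finset.range (p + 1), (insertZero k z j - insertZero k z (j + 1))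
      = ∑ k ∈ Finset.range (p + 1), (F (k + 1) - F k) / z k /
        ∏ j ∈ Finset.range p, (z j - z (j + 1)) := by
  set D := ∏ j ∈ Finset.range p, (z j - z (j + 1)) with hD
  have hD0 : D ≠ 0 := Finset.prod_ne_zero_iff.2 fun j _ => sub_ne_zero.2 (hne j)
  have mid : ∀ k ∈ Finset.range p, F (k + 1) /
      ∏ j ∈ Finset.range (p + 1), (insertZero (k + 1) z j - insertZero (k + 1) z (j + 1))
        = F (k + 1) / z k / D - F (k + 1) / z (k + 1) / D := by
    intro k hk
    have hk := prod_insertZero_succ z (Finset.mem_range.1 hk)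
    rw [← hD, ← eq_div_iff (sub_ne_zero.2 (hne k))] at hk
    have h1 := h0 k
    have h2 := h0 (k + 1)
    have h3 := sub_ne_zero.2 (hne k)
    rw [hk]
    field_simp
    ring
  rw [Finset.sum_range_succ, Finset.sum_range_succ', Finset.sum_congr rfl mid,
    prod_insertZero_zero, prod_insertZero_of_le, ← hD, Finset.sum_sub_distrib]
  simp only [sub_div]
  rw [Finset.sum_sub_distrib, Finset.sum_range_succ, Finset.sum_range_succ' (fun k => F k / z k / D)]
  ring

/-- The permutation of `Fin (m + 1)` taking `k` to the last element and the other elements, in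
order, to the values of `τ`. -/
def permInsert {m : ℕ} (k : Fin (m + 1)) (τ : Equiv.Perm (Fin m)) : Equiv.Perm (Fin (m + 1)) :=
  (finSuccEquiv' k).trans ((Equiv.optionCongr τ).trans (finSuccEquiv' (Fin.last m)).symm)

theorem permInsert_self {m : ℕ} (k : Fin (m + 1)) (τ : Equiv.Perm (Fin m)) :
    permInsert k τ k = Fin.last m := by
  simp [permInsert]

theorem permInsert_succAbove {m : ℕ} (k : Fin (m + 1)) (τ : Equiv.Perm (Fin m)) (j : Fin m) :
    permInsert k τ (k.succAbove j) = (τ j).castSucc := by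
  simp [permInsert]

theorem permInsert_bijective (m : ℕ) :
    Function.Bijective fun x : Fin (m + 1) × Equiv.Perm (Fin m) => permInsert x.1 x.2 := by
  rw [Fintype.bijective_iff_injective_and_card]
  constructor
  · rintro ⟨k, τ⟩ ⟨k', τ'⟩ h
    dsimp only at h
    obtain rfl : k = k' := by
      have h1 := permInsert_self k τ
      rw [h, ← permInsert_self k' τ'] at h1
      exact (permInsert k' τ').injective h1
    obtain rfl : τ = τ' := by
      ext1 j
      have h1 := permInsert_succAbove k τ j
      rw [h, permInsert_succAbove] at h1
      exact (Fin.castSucc_injective m h1).symm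
    rfl
  · rw [Fintype.card_prod, Fintype.card_perm, Fintype.card_perm, Fintype.card_fin,
      Fintype.card_fin, Nat.factorial_succ]

theorem insertZero_extendPerm_permInsert {m : ℕ} (k : Fin (m + 1)) (τ : Equiv.Perm (Fin m))
    (y : ℕ → K) (j : ℕ) : insertZero m y (extendPerm (permInsert k τ) j)
      = insertZero k (fun i => y (extendPerm τ i)) j := by
  rcases Nat.lt_or_ge m j with hj | hj
  · obtain ⟨j, rfl⟩ : ∃ r, j = r + 1 := ⟨j - 1, by omega⟩
    rw [extendPerm_of_le _ (by omega), insertZero_succ _ (by omega),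
      insertZero_succ _ (by omega), extendPerm_of_le _ (by omega)]
  · obtain ⟨j, rfl⟩ : ∃ r : Fin (m + 1), j = r := ⟨⟨j, by omega⟩, rfl⟩
    rw [extendPerm_val]
    rcases Fin.eq_self_or_eq_succAbove k j with rfl | ⟨i, rfl⟩
    · rw [permInsert_self, insertZero_self, Fin.val_last, insertZero_self]
    · rw [permInsert_succAbove, Fin.val_castSucc, insertZero_of_lt _ (τ i).isLt]
      rcases Nat.lt_or_ge i k with h | h
      · rw [Fin.succAbove_of_castSucc_lt _ _ h, Fin.val_castSucc, insertZero_of_lt _ h,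
          extendPerm_val]
      · rw [Fin.succAbove_of_le_castSucc _ _ h, Fin.val_succ, insertZero_succ _ h,
          extendPerm_val]

/-- Setting the last variable to `0` in the divided symmetrization of `f` gives the divided
symmetrization, in one variable less, of the sum of the `T_k f`. -/
theorem dividedSymmAt_insertZero (p : ℕ) (f : ZPoly) {y : ℕ → K} (hy : Function.Injective y)
    (hy0 : ∀ j, y j ≠ 0) : dividedSymmAt (p + 2) f (insertZero (p + 1) y)
      = ∑ k ∈ Finset.range (p + 1), dividedSymmAt (p + 1) (trim k f) y := by
  simp only [dividedSymmAt]
  rw [Finset.sum_comm, ← (permInsert_bijective (p + 1)).sum_comp, Fintype.sum_prod_type_right]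
  refine Finset.sum_congr rfl fun τ _ => ?_
  simp only [insertZero_extendPerm_permInsert]
  rw [Fin.sum_univ_eq_sum_range fun k => aeval (insertZero k fun i => y (extendPerm τ i)) f /
    ∏ j ∈ Finset.range (p + 2 - 1), (insertZero k (fun i => y (extendPerm τ i)) j
      - insertZero k (fun i => y (extendPerm τ i)) (j + 1))]
  have hz0 : ∀ j, y (extendPerm τ j) ≠ 0 := fun j => hy0 _
  refine (sum_div_prod_insertZero _ _ p hz0 fun j h => ?_).trans
    (Finset.sum_congr rfl fun k _ => ?_)
  · exact absurd ((extendPerm τ).injective (hy h)) (Nat.succ_ne_self j).symm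
  · rw [aeval_insertZero, aeval_insertZero, ← map_sub, ← X_mul_trim, map_mul, aeval_X,
      mul_div_cancel_left₀ _ (hz0 k)]
    rfl

end

/-- On homogeneous polynomials of degree `m`, the divided symmetrization in `m + 1` variables is the
sum of the compositions of the operators `T`. -/
theorem dividedSymm_eq_trimSum {m : ℕ} {f : ZPoly} (hf : f.IsHomogeneous m) :
    dividedSymm (m + 1) f = (trimSum m f : FractionRing ZPoly) := by
  rw [dividedSymm_eq_dividedSymmAt]
  set y : ℕ → FractionRing ZPoly := fun j => algebraMap ZPoly (FractionRing ZPoly) (X j) with hy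
  have hinj : Function.Injective y :=
    (IsFractionRing.injective ZPoly (FractionRing ZPoly)).comp X_injective
  have h0 : ∀ j, y j ≠ 0 := fun j =>
    (map_ne_zero_iff _ (IsFractionRing.injective ZPoly (FractionRing ZPoly))).2 (X_ne_zero j)
  clear_value y
  induction m generalizing f with
  | zero =>
    rw [totalDegree_eq_zero_iff_eq_C.1 ((totalDegree_zero_iff_isHomogeneous ℕ).2 hf)]
    simp [dividedSymmAt, trimSum_zero]
  | succ m ih =>
    obtain ⟨c, hc⟩ := exists_dividedSymmAt_eq_intCast (K := FractionRing ZPoly) (n := m + 2) hf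
    rw [hc y hinj.injOn, ← hc (insertZero (m + 1) y), dividedSymmAt_insertZero m f hinj h0,
      trimSum_succ, Int.cast_sum]
    · exact Finset.sum_congr rfl fun k _ => ih (isHomogeneous_trim hf)
    · intro i hi j hj h
      simp only [Set.mem_Iio] at hi hj
      rcases Nat.lt_or_ge i (m + 1) with h1 | h1 <;> rcases Nat.lt_or_ge j (m + 1) with h2 | h2
      · rw [insertZero_of_lt _ h1, insertZero_of_lt _ h2] at h
        exact hinj h
      · obtain rfl : j = m + 1 := by omega
        rw [insertZero_of_lt _ h1, insertZero_self] at h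
        exact absurd h (h0 i)
      · obtain rfl : i = m + 1 := by omega
        rw [insertZero_of_lt _ h2, insertZero_self] at h
        exact absurd h.symm (h0 j)
      · omega

theorem mainTheorem9 (n : ℕ) (w : Equiv.Perm (Fin n)) (hw : permLength w + 1 = n) :
    (∃ i : Fin (n - 1) → ℕ, (∀ j, i j ≤ (j : ℕ)) ∧
      ∃ c : ℤ, 0 < c ∧ (List.ofFn i).foldr trim (schubert w) = MvPolynomial.C c) ∧
    ∃ a : ℤ, 0 < a ∧ dividedSymm n (schubert w) = (a : FractionRing ZPoly) := by
  obtain ⟨m, rfl⟩ : ∃ m, n = m + 1 := ⟨permLength w, hw.symm⟩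
  have hlen : permLength w = m := Nat.succ_injective hw
  have hhom := isHomogeneous_schubert w
  rw [hlen] at hhom
  have hpos : 0 < trimSum m (schubert w) := by
    simpa using trimSum_prod_varSum_mul_schubert_pos w [] (by simpa using hlen) (by simp)
  exact ⟨exists_foldr_trim_pos hhom hpos, _, hpos, dividedSymm_eq_trimSum hhom⟩
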